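/- Let $n\ge 1$ be an integer, let $(c(i,j))_{1\le i,j\le n}$ be independent standard Gaussian random variables, and for a permutation $u$ of $\{1,\dots,n\}$ put $g_{n,u}=n^{-1/2}\sum_{i=1}^n c(i,u(i))$. Let $M_n=\max_u g_{n,u}$, the maximum being over all $n!$ permutations, and for $\varepsilon>0$ let $A_n(\varepsilon)=\{u : g_{n,u}>(1-\varepsilon)\,\mathbb{E}M_n\}$ be the near-maximal set. Write $\mathbb{E}[X;A]=\mathbb{E}[X\mathbf 1_A]$. Then there are universal constants $C'$ and $C''$ such that, for all $n\ge1$, $$\mathbb{E}\bigl[\log|A_n(\varepsilon)|\,;\,A_n(\varepsilon)\ne\varnothing\bigr]\le\begin{cases} C'(n\log n)^{3/4} & \text{if } 0<\varepsilon\le(2n\log n)^{-1/2},\\ C''\sqrt{\varepsilon}\;n\log n & \text{if } (2n\log n)^{-1/2}<\varepsilon<1,\end{cases}$$ where for $n=1$ both bounds read $0$ (and both hold, whichever case is taken to apply). All expectations here are finite. Moreover, for every sequence $\varepsilon_n>0$ with $\varepsilon_n\to0$, the expected dimension of the near-maximal set tends to zero: $$\lim_{n\to\infty}\mathbb{E}\left[\frac{\log|A_n(\varepsilon_n)|}{\log(n!)}\,;\,A_n(\varepsilon_n)\ne\varnothing\right]=0.$$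 -/

import Mathlib

open MeasureTheory ProbabilityTheory Filter Topology

noncomputable section

/-- The entries of the random `n × n` matrix `c` are independent standard Gaussian random
variables on the probability space `(Ω, P)`. -/
structure IsStdGaussianMatrix {Ω : Type*} [MeasurableSpace Ω] (P : Measure Ω) {n : ℕ}
    (c : Fin n → Fin n → Ω → ℝ) : Prop where
  /-- Each entry has the standard Gaussian law. -/
  hasLaw : ∀ i j, HasLaw (c i j) (gaussianReal 0 1) P
  /-- All `n ^ 2` entries are jointly independent. -/
  indep : iIndepFun (fun p : Fin n × Fin n => c p.1 p.2) P

/-- The random assignment field: `g_{n,u} = n^{-1/2} ∑ i, c (i, u i)` for a permutation `u`. -/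
def assignmentField {Ω : Type*} {n : ℕ} (c : Fin n → Fin n → Ω → ℝ)
    (u : Equiv.Perm (Fin n)) (ω : Ω) : ℝ :=
  (1 / √(n : ℝ)) * ∑ i, c i (u i) ω

/-- The maximum `M = max_u g_u` of a random field with a finite index set. -/
def fieldMax {Ω ι : Type*} [Fintype ι] [Nonempty ι] (g : ι → Ω → ℝ) (ω : Ω) : ℝ :=
  Finset.univ.sup' Finset.univ_nonempty (fun u => g u ω)

/-- The (random) near-maximal set `A(ε) = {u : g_u > (1 - ε) E[M]}` of a field. -/
def nearMaximalSet {Ω ι : Type*} [MeasurableSpace Ω] [Fintype ι] [Nonempty ι]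
    (P : Measure Ω) (g : ι → Ω → ℝ) (ε : ℝ) (ω : Ω) : Finset ι :=
  Finset.univ.filter (fun u => g u ω > (1 - ε) * ∫ ω', fieldMax g ω' ∂P)

/-- The random variable `log |A(ε)| · 𝟙{A(ε) ≠ ∅}`, whose expectation is
`E[log |A(ε)| ; A(ε) ≠ ∅]`. -/
def logCardNearMaximal {Ω ι : Type*} [MeasurableSpace Ω] [Fintype ι] [Nonempty ι]
    (P : Measure Ω) (g : ι → Ω → ℝ) (ε : ℝ) : Ω → ℝ :=
  Set.indicator {ω | (nearMaximalSet P g ε ω).Nonempty}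
    (fun ω => Real.log ((nearMaximalSet P g ε ω).card : ℝ))

end

/-! Write `g_u(x)` for the field at the cost matrix `x`, `M` for its maximum and `m` for the mean of
`M`. Perturb `x` by an independent copy `y` and compare two estimates of the mean of `M (x + s •
y)`. By rotation invariance it equals `√(1 + s²) m`, which exceeds `m` by at most `s² m / 2`. On the
other hand, for fixed `x` with near-maximal set `A` nonempty, maximizing over `A` alone gives a
`y`-mean of at least `(1 - ε) m + s · width(A)`, where the width is the mean of `max_{u ∈ A} g_u`.
If `A` is empty, the mean is still at least `M x`, which is within `|M x - m|` of `m`. Hence a large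
expected width is impossible (`le_integral_dualMax_translate`, `integral_canonicalLogCard_le`).

Two further facts are needed. First, the mean of `|M - m|` is bounded independently of `n`
(`integral_abs_dualMax_sub_le`); this follows by rotating one matrix into an independent one in many
small steps. Second, the width controls the cardinality: `log |A| ≤ 4 √(n log n) · width(A) + 1`
(`log_card_le_assignmentWidth`). For this, take the Gibbs measure on `A` at inverse temperature `β`,
with marginals `f i j` of `u i = j`. Gaussian integration by parts gives its mean energy as `β / n`
times the mean of `∑ f (1 - f)`, and the entropy of a random permutation is at most `log (n (n + 1))
∑ f (1 - f) + 1`. Since `log |A|` plus `β` times the average of the field over `A`, a term of mean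
zero, is at most `β · energy + entropy`, a small width forces a small `log |A|`.

With `m ≤ 2 √(n log n)`, the two regimes come from `s = (n log n)^(-1/4)` and `s = √ε`; the limit
follows on dividing by `log n!`. -/

set_option linter.unusedSectionVars false

/-! ### Maxima of finite random fields. -/

section FieldMax

variable {Ω ι : Type*} [Fintype ι] [Nonempty ι]

lemma le_fieldMax (g : ι → Ω → ℝ) (u : ι) (ω : Ω) : g u ω ≤ fieldMax g ω :=
  Finset.le_sup' (fun u => g u ω) (Finset.mem_univ u)

lemma exists_eq_fieldMax (g : ι → Ω → ℝ) (ω : Ω) : ∃ u, fieldMax g ω = g u ω := by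
  obtain ⟨u, -, hu⟩ := Finset.exists_mem_eq_sup' Finset.univ_nonempty (fun u => g u ω)
  exact ⟨u, hu⟩

lemma measurable_fieldMax [MeasurableSpace Ω] {g : ι → Ω → ℝ} (hg : ∀ u, Measurable (g u)) :
    Measurable (fieldMax g) := by
  have := Finset.measurable_sup' (s := Finset.univ) Finset.univ_nonempty
    (f := g) (fun u _ => hg u)
  convert this using 1
  ext ω
  simp [fieldMax, Finset.sup'_apply]

lemma abs_fieldMax_le (g : ι → Ω → ℝ) (ω : Ω) : |fieldMax g ω| ≤ ∑ u, |g u ω| := by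
  obtain ⟨u, hu⟩ := exists_eq_fieldMax g ω
  rw [hu]
  exact Finset.single_le_sum (f := fun u => |g u ω|) (fun _ _ => abs_nonneg _) (Finset.mem_univ u)

lemma integrable_fieldMax [MeasurableSpace Ω] {μ : Measure Ω} {g : ι → Ω → ℝ}
    (hm : ∀ u, Measurable (g u)) (hg : ∀ u, Integrable (g u) μ) : Integrable (fieldMax g) μ := by
  refine Integrable.mono' (g := fun ω => ∑ u, |g u ω|)
    (integrable_finsetSum _ fun u _ => (hg u).abs) (measurable_fieldMax hm).aestronglyMeasurable ?_
  exact ae_of_all _ fun ω => abs_fieldMax_le g ω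

end FieldMax

/-- The first absolute moment of the standard Gaussian law. -/
noncomputable def gaussianAbsMoment : ℝ := ∫ t, |t| ∂(gaussianReal 0 1)

lemma integrable_id_stdGaussianReal : Integrable (fun t : ℝ => t) (gaussianReal 0 1) :=
  (memLp_id_gaussianReal (μ := 0) (v := 1) 1).integrable (by simp)

/-! ### Maxima of unit-variance Gaussian functionals: mean and concentration. -/

section GaussianField

variable {E : Type*} [NormedAddCommGroup E] [NormedSpace ℝ E] [MeasurableSpace E] [BorelSpace E]
  [SecondCountableTopology E] [CompleteSpace E] {μ : Measure E} [IsGaussian μ]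
  {ι : Type*} [Fintype ι] [Nonempty ι] {L : ι → StrongDual ℝ E}

/-- The maximum of finitely many continuous linear functionals. -/
noncomputable def dualMax (L : ι → StrongDual ℝ E) : E → ℝ := fieldMax (fun u x => L u x)

lemma dualMax_smul {a : ℝ} (ha : 0 ≤ a) (x : E) : dualMax L (a • x) = a * dualMax L x := by
  apply le_antisymm
  · obtain ⟨u, hu⟩ := exists_eq_fieldMax (fun u x => L u x) (a • x)
    rw [dualMax, hu, map_smul, smul_eq_mul]
    exact mul_le_mul_of_nonneg_left (le_fieldMax (fun u x => L u x) u x) ha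
  · obtain ⟨u, hu⟩ := exists_eq_fieldMax (fun u x => L u x) x
    have hu' : dualMax L x = L u x := hu
    rw [hu', ← smul_eq_mul, ← map_smul]
    exact le_fieldMax (fun u x => L u x) u (a • x)

@[fun_prop]
lemma measurable_dualMax : Measurable (dualMax L) :=
  measurable_fieldMax fun u => by fun_prop

lemma integrable_of_map_eq (hL : ∀ u, μ.map (L u) = gaussianReal 0 1) (u : ι) :
    Integrable (fun x => L u x) μ := by
  have h := integrable_id_stdGaussianReal
  rw [← hL u, integrable_map_measure (by fun_prop) (by fun_prop)] at h
  exact h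

lemma integrable_dualMax (hL : ∀ u, μ.map (L u) = gaussianReal 0 1) :
    Integrable (dualMax L) μ :=
  integrable_fieldMax (fun u => by fun_prop) (integrable_of_map_eq hL)

lemma integral_abs_of_map_eq (hL : ∀ u, μ.map (L u) = gaussianReal 0 1) (u : ι) :
    ∫ x, |L u x| ∂μ = gaussianAbsMoment := by
  rw [gaussianAbsMoment, ← hL u, integral_map (by fun_prop) (by fun_prop)]

lemma integral_of_map_eq (hL : ∀ u, μ.map (L u) = gaussianReal 0 1) (u : ι) :
    ∫ x, L u x ∂μ = 0 := by
  have := integral_id_gaussianReal (μ := 0) (v := 1)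
  rw [← hL u, integral_map (by fun_prop) (by fun_prop)] at this
  exact this

lemma integral_exp_of_map_eq (hL : ∀ u, μ.map (L u) = gaussianReal 0 1) (u : ι) (β : ℝ) :
    ∫ x, Real.exp (β * L u x) ∂μ = Real.exp (β ^ 2 / 2) := by
  have := mgf_gaussianReal (hL u) β
  simpa [mgf] using this

/-- A non-integrable function has Bochner integral `0` by convention, whereas the value already
computed is positive. -/
lemma integrable_exp_of_map_eq (hL : ∀ u, μ.map (L u) = gaussianReal 0 1) (u : ι) (β : ℝ) :
    Integrable (fun x => Real.exp (β * L u x)) μ := by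
  by_contra h
  have := integral_exp_of_map_eq hL u β
  rw [integral_undef h] at this
  exact (Real.exp_pos _).ne this

lemma integral_dualMax_nonneg (hL : ∀ u, μ.map (L u) = gaussianReal 0 1) :
    0 ≤ ∫ x, dualMax L x ∂μ := by
  obtain ⟨u⟩ := ‹Nonempty ι›
  rw [← integral_of_map_eq hL u]
  exact integral_mono (integrable_of_map_eq hL u) (integrable_dualMax hL)
    fun x => le_fieldMax (fun u x => L u x) u x

/-- The exponential of `β` times the maximum is at most the sum of the exponentials, whose mean is
the number of functionals times `exp (β² / 2)`. -/
lemma integral_dualMax_le (hL : ∀ u, μ.map (L u) = gaussianReal 0 1) {β : ℝ} (hβ : 0 < β) :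
    ∫ x, dualMax L x ∂μ ≤ Real.log (Fintype.card ι) / β + β / 2 := by
  have hN : (0 : ℝ) < Fintype.card ι := by exact_mod_cast Fintype.card_pos
  -- This value makes `card ι * exp (β² / 2) * exp (-β m) = 1`, so the correction term in `key` has
  -- mean zero.
  set m := Real.log (Fintype.card ι) / β + β / 2 with hm
  -- `t ≤ m + (exp (β (t - m)) - 1) / β`
  have key : ∀ x, dualMax L x ≤
      m + ((∑ u, Real.exp (β * L u x)) * Real.exp (-(β * m)) - 1) / β := by
    intro x
    obtain ⟨u, hu⟩ := exists_eq_fieldMax (fun u x => L u x) x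
    rw [dualMax, hu]
    have h1 : Real.exp (β * L u x) ≤ ∑ u, Real.exp (β * L u x) :=
      Finset.single_le_sum (f := fun u => Real.exp (β * L u x))
        (fun _ _ => (Real.exp_pos _).le) (Finset.mem_univ u)
    have h2 := Real.add_one_le_exp (β * L u x + -(β * m))
    rw [Real.exp_add] at h2
    have h3 := mul_le_mul_of_nonneg_right h1 (Real.exp_pos (-(β * m))).le
    rw [← sub_le_iff_le_add', le_div_iff₀ hβ]
    linarith
  have hint : Integrable (fun x => ∑ u, Real.exp (β * L u x)) μ :=
    integrable_finsetSum _ fun u _ => integrable_exp_of_map_eq hL u β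
  calc ∫ x, dualMax L x ∂μ
      ≤ ∫ x, (m + ((∑ u, Real.exp (β * L u x)) * Real.exp (-(β * m)) - 1) / β) ∂μ :=
        integral_mono (integrable_dualMax hL)
          ((integrable_const _).add (((hint.mul_const _).sub (integrable_const _)).div_const _)) key
    _ = m := by
        have hsub : Integrable (fun x => ((∑ u, Real.exp (β * L u x)) * Real.exp (-(β * m)) - 1) / β)
            μ := ((hint.mul_const _).sub (integrable_const _)).div_const _
        rw [integral_add (integrable_const _) hsub, integral_div,
          integral_sub (hint.mul_const _) (integrable_const _), integral_mul_const,
          integral_finsetSum _ fun u _ => integrable_exp_of_map_eq hL u β]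
        simp only [integral_exp_of_map_eq hL, Finset.sum_const, Finset.card_univ, nsmul_eq_mul,
          integral_const, probReal_univ, one_smul]
        have : (Fintype.card ι : ℝ) = Real.exp (Real.log (Fintype.card ι)) :=
          (Real.exp_log hN).symm
        rw [this, ← Real.exp_add, ← Real.exp_add]
        have h0 : Real.log (Fintype.card ι) + β ^ 2 / 2 + -(β * m) = 0 := by
          rw [hm]; field_simp; ring
        rw [h0]; simp

/-- Rotation invariance of `μ ⊗ μ` as a change of variables. -/
lemma integral_comp_rotation (hμ : ∀ l : StrongDual ℝ E, μ[l] = 0) (θ : ℝ) {F : E × E → ℝ}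
    (hF : Measurable F) :
    ∫ p, F (ContinuousLinearMap.rotation θ p) ∂(μ.prod μ) = ∫ p, F p ∂(μ.prod μ) := by
  conv_rhs => rw [← IsGaussian.map_rotation_eq_self_of_forall_strongDual_eq_zero hμ θ]
  rw [integral_map (by fun_prop) hF.aestronglyMeasurable]

lemma integrable_comp_rotation (hμ : ∀ l : StrongDual ℝ E, μ[l] = 0) (θ : ℝ) {F : E × E → ℝ}
    (hF : Measurable F) (hi : Integrable F (μ.prod μ)) :
    Integrable (fun p => F (ContinuousLinearMap.rotation θ p)) (μ.prod μ) := by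
  rw [← IsGaussian.map_rotation_eq_self_of_forall_strongDual_eq_zero hμ θ,
    integrable_map_measure hF.aestronglyMeasurable (by fun_prop)] at hi
  exact hi

lemma integrable_dualMax_rotation (hμ : ∀ l : StrongDual ℝ E, μ[l] = 0)
    (hL : ∀ u, μ.map (L u) = gaussianReal 0 1) (θ : ℝ) :
    Integrable (fun p => dualMax L (ContinuousLinearMap.rotation θ p).1) (μ.prod μ) :=
  integrable_comp_rotation hμ θ (F := fun p => dualMax L p.1) (by fun_prop)
    ((integrable_dualMax hL).comp_fst μ)

/-- The vector `(1, s)` has length `√(1 + s²)` and direction angle `arctan s`, so a perturbation is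
a scaled rotation, and the maximum is positively homogeneous. -/
lemma dualMax_add_smul (s : ℝ) (p : E × E) :
    dualMax L (p.1 + s • p.2) =
      √(1 + s ^ 2) * dualMax L (ContinuousLinearMap.rotation (Real.arctan s) p).1 := by
  rw [← dualMax_smul (by positivity)]
  have h : √(1 + s ^ 2) ≠ 0 := by positivity
  congr 1
  simp only [ContinuousLinearMap.rotation_apply, smul_add, smul_smul, Real.cos_arctan,
    Real.sin_arctan]
  rw [mul_one_div_cancel h, mul_div_cancel₀ _ h, one_smul]

lemma integrable_dualMax_add_smul (hμ : ∀ l : StrongDual ℝ E, μ[l] = 0)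
    (hL : ∀ u, μ.map (L u) = gaussianReal 0 1) (s : ℝ) :
    Integrable (fun p : E × E => dualMax L (p.1 + s • p.2)) (μ.prod μ) := by
  simp_rw [dualMax_add_smul]
  exact (integrable_dualMax_rotation hμ hL _).const_mul _

lemma integral_dualMax_add_smul (hμ : ∀ l : StrongDual ℝ E, μ[l] = 0) (s : ℝ) :
    ∫ p : E × E, dualMax L (p.1 + s • p.2) ∂(μ.prod μ) = √(1 + s ^ 2) * ∫ x, dualMax L x ∂μ := by
  simp_rw [dualMax_add_smul]
  rw [integral_const_mul,
    integral_comp_rotation hμ _ (F := fun p => dualMax L p.1) (by fun_prop), integral_fun_fst]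
  simp

/-- The mean displacement of the maximum under a rotation by the angle `θ`. -/
noncomputable def rotationGap (μ : Measure E) (L : ι → StrongDual ℝ E) (θ : ℝ) : ℝ :=
  ∫ p, |dualMax L (ContinuousLinearMap.rotation θ p).1 - dualMax L p.1| ∂(μ.prod μ)

lemma rotation_add_apply (a b : ℝ) (p : E × E) :
    ContinuousLinearMap.rotation a (ContinuousLinearMap.rotation b p) =
      ContinuousLinearMap.rotation (a + b) p := by
  simp only [ContinuousLinearMap.rotation_apply, Real.cos_add, Real.sin_add, Prod.mk.injEq]
  constructor <;> module

/-- Rotation by `b` preserves `μ ⊗ μ`, so the displacement from angle `b` to `a + b` has the same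
law as that from `0` to `a`; then the triangle inequality applies. -/
lemma rotationGap_add_le (hμ : ∀ l : StrongDual ℝ E, μ[l] = 0)
    (hL : ∀ u, μ.map (L u) = gaussianReal 0 1) (a b : ℝ) :
    rotationGap μ L (a + b) ≤ rotationGap μ L a + rotationGap μ L b := by
  have hI := integrable_dualMax_rotation hμ hL
  have h0 := (integrable_dualMax hL).comp_fst μ
  have h1 : rotationGap μ L a = ∫ p, |dualMax L (ContinuousLinearMap.rotation (a + b) p).1
      - dualMax L (ContinuousLinearMap.rotation b p).1| ∂(μ.prod μ) := by
    rw [rotationGap, ← integral_comp_rotation hμ b (by fun_prop)]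
    simp_rw [rotation_add_apply]
  have hA : Integrable (fun p => |dualMax L (ContinuousLinearMap.rotation (a + b) p).1
      - dualMax L (ContinuousLinearMap.rotation b p).1|) (μ.prod μ) := ((hI _).sub (hI _)).abs
  have hB : Integrable (fun p => |dualMax L (ContinuousLinearMap.rotation b p).1
      - dualMax L p.1|) (μ.prod μ) := ((hI _).sub h0).abs
  rw [h1, rotationGap, rotationGap, ← integral_add hA hB]
  exact integral_mono ((hI _).sub h0).abs (hA.add hB)
    fun p => abs_sub_le _ _ _

/-- Test the rotated maximum on the functional `u` that is maximal at `x`. Since `u` depends on `x`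
only, `L u y` is still standard Gaussian in `y`, so its absolute moment brings in no dependence on
the number of functionals. -/
lemma integral_posPart_sub_rotation_le (hμ : ∀ l : StrongDual ℝ E, μ[l] = 0)
    (hL : ∀ u, μ.map (L u) = gaussianReal 0 1) (θ : ℝ) :
    ∫ p, max (dualMax L p.1 - dualMax L (ContinuousLinearMap.rotation θ p).1) 0 ∂(μ.prod μ) ≤
      (1 - Real.cos θ) * (∫ x, |dualMax L x| ∂μ) + |Real.sin θ| * gaussianAbsMoment := by
  have hI := (((integrable_dualMax hL).comp_fst μ).sub
    (integrable_dualMax_rotation hμ hL θ)).pos_part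
  have hM := (integrable_dualMax hL).abs
  have hc : 0 ≤ 1 - Real.cos θ := by linarith [Real.cos_le_one θ]
  have hlin : Integrable (fun x => (1 - Real.cos θ) * |dualMax L x| +
      |Real.sin θ| * gaussianAbsMoment) μ := (hM.const_mul _).add (integrable_const _)
  have hrhs : ∫ x, ((1 - Real.cos θ) * |dualMax L x| + |Real.sin θ| * gaussianAbsMoment) ∂μ =
      (1 - Real.cos θ) * (∫ x, |dualMax L x| ∂μ) + |Real.sin θ| * gaussianAbsMoment := by
    rw [integral_add (hM.const_mul _) (integrable_const _), integral_const_mul]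
    simp
  rw [← hrhs]
  simp only [Pi.sub_apply] at hI
  rw [integral_prod _ hI]
  refine integral_mono_of_nonneg (ae_of_all _ fun x => integral_nonneg fun y => le_max_right _ _)
    hlin (ae_of_all _ fun x => ?_)
  obtain ⟨u, hu⟩ := exists_eq_fieldMax (fun u x => L u x) x
  have hu' : dualMax L x = L u x := hu
  have habs := (integrable_of_map_eq hL u).abs
  have hb : ∀ y, max (dualMax L x - dualMax L (ContinuousLinearMap.rotation θ (x, y)).1) 0 ≤
      (1 - Real.cos θ) * |dualMax L x| + |Real.sin θ| * |L u y| := by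
    intro y
    refine max_le ?_ (by positivity)
    have h1 := le_fieldMax (fun u x => L u x) u (ContinuousLinearMap.rotation θ (x, y)).1
    simp only [ContinuousLinearMap.rotation_apply, map_add, map_smul, smul_eq_mul] at h1
    have h2 := mul_le_mul_of_nonneg_left (le_abs_self (L u x)) hc
    have h3 := neg_abs_le (Real.sin θ * L u y)
    rw [abs_mul] at h3
    rw [hu']
    change Real.cos θ * L u x + Real.sin θ * L u y ≤ dualMax L _ at h1
    simp only [ContinuousLinearMap.rotation_apply]
    linarith
  calc _ ≤ ∫ y, ((1 - Real.cos θ) * |dualMax L x| + |Real.sin θ| * |L u y|) ∂μ :=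
        integral_mono_of_nonneg (ae_of_all _ fun y => le_max_right _ _)
          ((integrable_const _).add (habs.const_mul _)) (ae_of_all _ hb)
    _ = _ := by
        rw [integral_add (integrable_const _) (habs.const_mul _),
          integral_const_mul (|Real.sin θ|), integral_abs_of_map_eq hL u]
        simp

lemma rotationGap_le (hμ : ∀ l : StrongDual ℝ E, μ[l] = 0)
    (hL : ∀ u, μ.map (L u) = gaussianReal 0 1) (θ : ℝ) :
    rotationGap μ L θ ≤
      2 * ((1 - Real.cos θ) * (∫ x, |dualMax L x| ∂μ) + |Real.sin θ| * gaussianAbsMoment) := by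
  have hI := integrable_dualMax_rotation hμ hL θ
  have h0 := (integrable_dualMax hL).comp_fst μ
  have h1 := integral_posPart_sub_rotation_le hμ hL θ
  have h2 := integral_posPart_sub_rotation_le hμ hL (-θ)
  -- Evaluating the bound for `-θ` at the point rotated by `θ` exchanges the two maxima, which
  -- supplies the opposite positive part.
  rw [← integral_comp_rotation hμ θ (by fun_prop)] at h2
  simp only [rotation_add_apply, neg_add_cancel, Real.cos_neg, Real.sin_neg, abs_neg] at h2
  have hz : ∀ p : E × E, ContinuousLinearMap.rotation 0 p = p := by
    intro p; simp [ContinuousLinearMap.rotation_apply]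
  simp only [hz] at h2
  have hsplit : rotationGap μ L θ =
      (∫ p, max (dualMax L p.1 - dualMax L (ContinuousLinearMap.rotation θ p).1) 0 ∂(μ.prod μ)) +
      ∫ p, max (dualMax L (ContinuousLinearMap.rotation θ p).1 - dualMax L p.1) 0 ∂(μ.prod μ) := by
    have hA := (h0.sub hI).pos_part
    have hB := (hI.sub h0).pos_part
    simp only [Pi.sub_apply] at hA hB
    rw [rotationGap, ← integral_add hA hB]
    refine integral_congr_ae (ae_of_all _ fun p => ?_)
    beta_reduce
    rcases le_total (dualMax L p.1) (dualMax L (ContinuousLinearMap.rotation θ p).1) with h | h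
    · rw [abs_of_nonneg (by linarith), max_eq_right (by linarith), max_eq_left (by linarith)]
      ring
    · rw [abs_of_nonpos (by linarith), max_eq_left (by linarith), max_eq_right (by linarith)]
      ring
  linarith

lemma rotationGap_nsmul_le (hμ : ∀ l : StrongDual ℝ E, μ[l] = 0)
    (hL : ∀ u, μ.map (L u) = gaussianReal 0 1) (θ : ℝ) (k : ℕ) :
    rotationGap μ L (k * θ) ≤ k * rotationGap μ L θ := by
  induction k with
  | zero => simp [rotationGap, ContinuousLinearMap.rotation_apply]
  | succ k ih =>
    have := rotationGap_add_le hμ hL (k * θ) θ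
    push_cast
    rw [add_mul, one_mul, add_mul, one_mul]
    linarith

/-- Cut the quarter turn into `k + 1` equal steps. The term containing the size of the maximum is
quadratic in the step, so its total is `O(1 / k)` and disappears in the limit; only the linear term
survives. -/
lemma rotationGap_pi_div_two_le (hμ : ∀ l : StrongDual ℝ E, μ[l] = 0)
    (hL : ∀ u, μ.map (L u) = gaussianReal 0 1) :
    rotationGap μ L (Real.pi / 2) ≤ Real.pi * gaussianAbsMoment := by
  set B := ∫ x, |dualMax L x| ∂μ
  have hB : 0 ≤ B := integral_nonneg fun _ => abs_nonneg _
  have hK : 0 ≤ gaussianAbsMoment := integral_nonneg fun _ => abs_nonneg _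
  have hbd : ∀ k : ℕ, rotationGap μ L (Real.pi / 2) ≤
      Real.pi * gaussianAbsMoment + (Real.pi ^ 2 / 4 * B) / ((k : ℝ) + 1) := by
    intro k
    have hk : (0 : ℝ) < (k : ℝ) + 1 := by positivity
    set θ := Real.pi / 2 / ((k : ℝ) + 1) with hθ
    have hθ0 : 0 ≤ θ := by positivity
    have h1 := rotationGap_nsmul_le hμ hL θ (k + 1)
    have h2 := rotationGap_le hμ hL θ
    push_cast at h1
    have e : ((k : ℝ) + 1) * θ = Real.pi / 2 := by rw [hθ]; field_simp
    rw [e] at h1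
    have h3 : 1 - Real.cos θ ≤ θ ^ 2 / 2 := by linarith [Real.one_sub_sq_div_two_le_cos (x := θ)]
    have h4 : |Real.sin θ| ≤ θ := by
      have := Real.abs_sin_le_abs (x := θ); rwa [abs_of_nonneg hθ0] at this
    have h5 : rotationGap μ L θ ≤ 2 * (θ ^ 2 / 2 * B + θ * gaussianAbsMoment) := by
      refine h2.trans ?_
      gcongr
    calc _ ≤ ((k : ℝ) + 1) * rotationGap μ L θ := h1
      _ ≤ ((k : ℝ) + 1) * (2 * (θ ^ 2 / 2 * B + θ * gaussianAbsMoment)) := by gcongr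
      _ = _ := by rw [hθ]; field_simp; ring
  have ht : Tendsto (fun k : ℕ => Real.pi * gaussianAbsMoment +
      (Real.pi ^ 2 / 4 * B) / ((k : ℝ) + 1)) atTop (𝓝 (Real.pi * gaussianAbsMoment + 0)) :=
    tendsto_const_nhds.add
      (tendsto_const_nhds.div_atTop (tendsto_natCast_atTop_atTop.atTop_add tendsto_const_nhds))
  rw [add_zero] at ht
  exact ge_of_tendsto' ht hbd

/-- The maximum of a Gaussian field of unit variance deviates from its mean by a bounded amount,
on average, whatever the number of functionals. -/
lemma integral_abs_dualMax_sub_le (hμ : ∀ l : StrongDual ℝ E, μ[l] = 0)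
    (hL : ∀ u, μ.map (L u) = gaussianReal 0 1) :
    ∫ x, |dualMax L x - ∫ y, dualMax L y ∂μ| ∂μ ≤ Real.pi * gaussianAbsMoment := by
  refine le_trans ?_ (rotationGap_pi_div_two_le hμ hL)
  have hM := integrable_dualMax (L := L) hL
  -- A quarter turn replaces the first component by the independent second one.
  have h1 : rotationGap μ L (Real.pi / 2) =
      ∫ p : E × E, |dualMax L p.2 - dualMax L p.1| ∂(μ.prod μ) := by
    simp [rotationGap, ContinuousLinearMap.rotation_apply]
  have h2 : Integrable (fun p : E × E => |dualMax L p.2 - dualMax L p.1|) (μ.prod μ) :=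
    ((hM.comp_snd μ).sub (hM.comp_fst μ)).abs
  rw [h1, integral_prod _ h2]
  refine integral_mono (hM.sub (integrable_const _)).abs h2.integral_prod_left fun x => ?_
  have h3 : ∫ y, (dualMax L y - dualMax L x) ∂μ = (∫ y, dualMax L y ∂μ) - dualMax L x := by
    rw [integral_sub hM (integrable_const _)]; simp
  calc |dualMax L x - ∫ y, dualMax L y ∂μ| = |∫ y, (dualMax L y - dualMax L x) ∂μ| := by
        rw [h3, abs_sub_comm]
    _ ≤ _ := abs_integral_le_integral_abs

end GaussianField

/-! ### Gaussian integration by parts, in one variable and coordinatewise. -/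

/-- Stein's identity for the standard Gaussian law. -/
lemma integral_id_mul_stdGaussianReal {f f' : ℝ → ℝ} (hf : ∀ t, HasDerivAt f (f' t) t)
    (hc : Continuous f') {C C' : ℝ} (hC : ∀ t, |f t| ≤ C) (hC' : ∀ t, |f' t| ≤ C') :
    ∫ t, t * f t ∂(gaussianReal 0 1) = ∫ t, f' t ∂(gaussianReal 0 1) := by
  have hfc : Continuous f := continuous_iff_continuousAt.2 fun t => (hf t).continuousAt
  have hpdf : ∀ t : ℝ, gaussianPDFReal 0 1 t =
      (√(2 * Real.pi))⁻¹ * Real.exp (-(1 / 2) * t ^ 2) := by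
    intro t
    rw [gaussianPDFReal]
    congr 2
    · simp
    · simp; ring
  have hder : ∀ t : ℝ, HasDerivAt (gaussianPDFReal 0 1) (-(t * gaussianPDFReal 0 1 t)) t := by
    intro t
    have h1 : HasDerivAt (fun t : ℝ => -(1 / 2) * t ^ 2) (-t) t := by
      refine ((hasDerivAt_pow 2 t).const_mul (-(1 / 2 : ℝ))).congr_deriv ?_
      push_cast
      ring
    have h2 := h1.exp.const_mul ((√(2 * Real.pi))⁻¹)
    rw [show gaussianPDFReal 0 1 = fun t => (√(2 * Real.pi))⁻¹ * Real.exp (-(1 / 2) * t ^ 2) from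
      funext hpdf]
    exact h2.congr_deriv (by ring)
  have hp : Integrable (gaussianPDFReal 0 1) := integrable_gaussianPDFReal 0 1
  have htp : Integrable (fun t : ℝ => -(t * gaussianPDFReal 0 1 t)) := by
    have := (integrable_mul_exp_neg_mul_sq (b := 1 / 2) (by norm_num)).const_mul
      ((√(2 * Real.pi))⁻¹)
    refine (this.neg).congr (ae_of_all _ fun t => ?_)
    simp only [Pi.neg_apply, hpdf]
    ring
  -- Boundedness of `f` and `f'` makes all three products integrable, so no boundary term remains.
  have h := integral_mul_deriv_eq_deriv_mul_of_integrable (u := f) (v := gaussianPDFReal 0 1)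
    (fun t _ => hf t) (fun t _ => hder t)
    (htp.bdd_mul hfc.aestronglyMeasurable (ae_of_all _ hC))
    (hp.bdd_mul hc.aestronglyMeasurable (ae_of_all _ hC'))
    (hp.bdd_mul hfc.aestronglyMeasurable (ae_of_all _ hC))
  rw [integral_gaussianReal_eq_integral_smul one_ne_zero,
    integral_gaussianReal_eq_integral_smul one_ne_zero]
  simp only [smul_eq_mul]
  have e1 : ∀ t, gaussianPDFReal 0 1 t * (t * f t) = -(f t * -(t * gaussianPDFReal 0 1 t)) := by
    intro t; ring
  have e2 : ∀ t, gaussianPDFReal 0 1 t * f' t = f' t * gaussianPDFReal 0 1 t := by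
    intro t; ring
  simp_rw [e1, e2]
  rw [integral_neg, h, neg_neg]

section Pi

variable {κ : Type*} [Fintype κ]

/-- The standard Gaussian measure on `κ → ℝ`. -/
noncomputable def stdGaussianPi (κ : Type*) [Fintype κ] : Measure (κ → ℝ) :=
  Measure.pi fun _ => gaussianReal 0 1

instance : IsProbabilityMeasure (stdGaussianPi κ) := by
  unfold stdGaussianPi; infer_instance

lemma iIndepFun_eval_stdGaussianPi :
    iIndepFun (fun (p : κ) (x : κ → ℝ) => x p) (stdGaussianPi κ) :=
  iIndepFun_pi (X := fun (_ : κ) (t : ℝ) => t) fun _ => aemeasurable_id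

lemma hasLaw_eval_stdGaussianPi (p : κ) :
    HasLaw (fun x : κ → ℝ => x p) (gaussianReal 0 1) (stdGaussianPi κ) :=
  ⟨(measurable_pi_apply p).aemeasurable, (measurePreserving_eval (fun _ : κ => gaussianReal 0 1) p).map_eq⟩

instance : IsGaussian (stdGaussianPi κ) := by
  have h := iIndepFun.hasGaussianLaw (P := stdGaussianPi κ) (X := fun (p : κ) (x : κ → ℝ) => x p)
    (fun p => (hasLaw_eval_stdGaussianPi p).hasGaussianLaw) iIndepFun_eval_stdGaussianPi
  have := h.isGaussian_map
  simpa using this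

lemma integrable_eval_stdGaussianPi (p : κ) :
    Integrable (fun x : κ → ℝ => x p) (stdGaussianPi κ) :=
  (hasLaw_eval_stdGaussianPi p).hasGaussianLaw.integrable

lemma integral_eval_stdGaussianPi (p : κ) : ∫ x, x p ∂(stdGaussianPi κ) = 0 := by
  have := (hasLaw_eval_stdGaussianPi p).integral_eq
  rw [this]
  simp

lemma integral_strongDual_stdGaussianPi (l : StrongDual ℝ (κ → ℝ)) :
    ∫ x, l x ∂(stdGaussianPi κ) = 0 := by
  classical
  have h : ∀ x, l x = ∑ p, x p * l (Pi.single p 1) := by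
    intro x
    rw [← l.coe_coe, LinearMap.pi_apply_eq_sum_univ (l : (κ → ℝ) →ₗ[ℝ] ℝ) x]
    refine Finset.sum_congr rfl fun p _ => ?_
    rw [smul_eq_mul]
    congr 2
    ext q
    by_cases h : q = p
    · subst h; simp
    · simp [h, Ne.symm h]
  rw [integral_congr_ae (ae_of_all _ h)]
  rw [integral_finsetSum _ fun p _ => (integrable_eval_stdGaussianPi p).mul_const _]
  refine Finset.sum_eq_zero fun p _ => ?_
  rw [integral_mul_const, integral_eval_stdGaussianPi, zero_mul]

/-- Resampling one coordinate preserves the standard Gaussian measure. -/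
lemma map_update_stdGaussianPi [DecidableEq κ] (p : κ) :
    ((stdGaussianPi κ).prod (gaussianReal 0 1)).map
      (fun q : (κ → ℝ) × ℝ => Function.update q.1 p q.2) = stdGaussianPi κ := by
  have hm : Measurable (fun q : (κ → ℝ) × ℝ => Function.update q.1 p q.2) := by
    rw [measurable_pi_iff]
    intro a
    by_cases h : a = p
    · subst h; simpa using measurable_snd
    · simp only [Function.update_of_ne h]; fun_prop
  symm
  refine Measure.pi_eq fun s hs => ?_
  rw [Measure.map_apply hm (MeasurableSet.univ_pi hs)]
  -- The old value of coordinate `p` is discarded, hence unconstrained; its factor of mass one is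
  -- replaced by that of the new value.
  have : (fun q : (κ → ℝ) × ℝ => Function.update q.1 p q.2) ⁻¹' (Set.univ.pi s) =
      (Set.univ.pi (Function.update s p Set.univ)) ×ˢ (s p) := by
    ext q
    simp only [Set.mem_preimage, Set.mem_pi, Set.mem_univ, true_imp_iff, Set.mem_prod]
    constructor
    · intro h
      refine ⟨fun i => ?_, by simpa using h p⟩
      by_cases hi : i = p
      · subst hi; simp
      · simpa [Function.update_of_ne hi] using h i
    · rintro ⟨h, h'⟩ i
      by_cases hi : i = p
      · subst hi; simpa using h'
      · simpa [Function.update_of_ne hi] using h i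
  rw [this, Measure.prod_prod, stdGaussianPi, Measure.pi_pi,
    ← Finset.mul_prod_erase _ _ (Finset.mem_univ p),
    ← Finset.mul_prod_erase (a := p) Finset.univ (fun i => gaussianReal 0 1 (s i)) (Finset.mem_univ p)]
  rw [mul_comm]
  congr 1
  simp only [Function.update_self, measure_univ, one_mul]
  refine Finset.prod_congr rfl fun i hi => ?_
  rw [Function.update_of_ne (Finset.ne_of_mem_erase hi)]

/-- Gaussian integration by parts in one coordinate. -/
lemma integral_eval_mul_stdGaussianPi [DecidableEq κ] (p : κ) {f f' : (κ → ℝ) → ℝ}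
    (hf : ∀ x t, HasDerivAt (fun t => f (Function.update x p t)) (f' (Function.update x p t)) t)
    (hfm : Continuous f) (hfm' : Continuous f') {C C' : ℝ} (hC : ∀ x, |f x| ≤ C)
    (hC' : ∀ x, |f' x| ≤ C') :
    ∫ x, x p * f x ∂(stdGaussianPi κ) = ∫ x, f' x ∂(stdGaussianPi κ) := by
  have hm : Measurable (fun q : (κ → ℝ) × ℝ => Function.update q.1 p q.2) := by
    have : Continuous (fun q : (κ → ℝ) × ℝ => Function.update q.1 p q.2) := by fun_prop
    exact this.measurable
  have hi : Integrable (fun x => x p * f x) (stdGaussianPi κ) :=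
    (integrable_eval_stdGaussianPi p).mul_bdd hfm.aestronglyMeasurable (ae_of_all _ hC)
  have hi' : Integrable f' (stdGaussianPi κ) :=
    Integrable.of_bound hfm'.aestronglyMeasurable C' (ae_of_all _ hC')
  have key : ∀ {F : (κ → ℝ) → ℝ}, Continuous F → Integrable F (stdGaussianPi κ) →
      ∫ x, F x ∂(stdGaussianPi κ) =
        ∫ x, ∫ t, F (Function.update x p t) ∂(gaussianReal 0 1) ∂(stdGaussianPi κ) := by
    intro F hF hFi
    have h1 := hFi
    rw [← map_update_stdGaussianPi p,
      integrable_map_measure hF.aestronglyMeasurable hm.aemeasurable] at h1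
    conv_lhs => rw [← map_update_stdGaussianPi p]
    rw [integral_map hm.aemeasurable hF.aestronglyMeasurable]
    exact integral_prod _ h1
  rw [key (by fun_prop) hi, key hfm' hi']
  congr 1 with x
  simp only [Function.update_self]
  exact integral_id_mul_stdGaussianReal (hf x) (by fun_prop) (fun t => hC _) (fun t => hC' _)

end Pi

/-! ### The assignment field as linear functionals of the cost matrix. -/

section Assignment

variable {n : ℕ}

/-- The random assignment field as a functional of the matrix of costs. -/
noncomputable def assignmentDual (n : ℕ) (u : Equiv.Perm (Fin n)) :
    StrongDual ℝ (Fin n × Fin n → ℝ) :=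
  (1 / √(n : ℝ)) • ∑ i, ContinuousLinearMap.proj (R := ℝ) (i, u i)

lemma assignmentDual_apply (u : Equiv.Perm (Fin n)) (x : Fin n × Fin n → ℝ) :
    assignmentDual n u x = 1 / √(n : ℝ) * ∑ i, x (i, u i) := by
  simp [assignmentDual]

/-- The `n` entries `(i, u i)` are distinct, hence independent, and `1 / √n` normalizes the variance
of their sum to one. -/
lemma map_assignmentDual (hn : 1 ≤ n) (u : Equiv.Perm (Fin n)) :
    (stdGaussianPi (Fin n × Fin n)).map (assignmentDual n u) = gaussianReal 0 1 := by
  rw [IsGaussian.map_eq_gaussianReal, integral_strongDual_stdGaussianPi]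
  have hn' : (n : ℝ) ≠ 0 := by positivity
  have hX : ∀ i : Fin n, MemLp (fun x : Fin n × Fin n → ℝ => x (i, u i)) 2
      (stdGaussianPi (Fin n × Fin n)) := fun i =>
    (hasLaw_eval_stdGaussianPi (i, u i)).hasGaussianLaw.memLp_two
  have h1 : Var[fun x => assignmentDual n u x; stdGaussianPi (Fin n × Fin n)] = 1 := by
    simp_rw [assignmentDual_apply]
    rw [variance_const_mul]
    have h2 := IndepFun.variance_sum (s := Finset.univ) (fun i _ => hX i)
      (fun i _ j _ hij => iIndepFun_eval_stdGaussianPi.indepFun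
        (i := (i, u i)) (j := (j, u j)) (by simp [hij]))
    have h3 : ∀ i : Fin n, Var[fun x : Fin n × Fin n → ℝ => x (i, u i);
        stdGaussianPi (Fin n × Fin n)] = 1 := by
      intro i
      rw [(hasLaw_eval_stdGaussianPi (i, u i)).variance_eq]
      simp
    simp only [h3] at h2
    have h4 : (fun x : Fin n × Fin n → ℝ => ∑ i, x (i, u i)) =
      ∑ i, (fun x : Fin n × Fin n → ℝ => x (i, u i)) := by ext x; simp
    rw [h4, h2]
    simp
    field_simp
  have h5 : Var[assignmentDual n u; stdGaussianPi (Fin n × Fin n)] = 1 := h1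
  rw [h5]
  simp

end Assignment

/-! ### Entropy of a random permutation in terms of its marginals. -/

section Entropy

variable {n : ℕ}

/-- The probability that `u i = j` when `u ∈ A` is drawn with weights `w`. -/
def permMarginal (A : Finset (Equiv.Perm (Fin n))) (w : Equiv.Perm (Fin n) → ℝ) (i j : Fin n) : ℝ :=
  ∑ u ∈ A with u i = j, w u

lemma sum_permMarginal (A : Finset (Equiv.Perm (Fin n))) (w : Equiv.Perm (Fin n) → ℝ) (i : Fin n) :
    ∑ j, permMarginal A w i j = ∑ u ∈ A, w u := by
  unfold permMarginal
  exact Finset.sum_fiberwise A (fun u => u i) w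

lemma sum_mul_permMarginal (A : Finset (Equiv.Perm (Fin n))) (w : Equiv.Perm (Fin n) → ℝ)
    (F : Fin n → Fin n → ℝ) :
    ∑ i, ∑ j, F i j * permMarginal A w i j = ∑ u ∈ A, w u * ∑ i, F i (u i) := by
  simp_rw [Finset.mul_sum]
  rw [Finset.sum_comm (s := A)]
  refine Finset.sum_congr rfl fun i _ => ?_
  rw [← Finset.sum_fiberwise A (fun u => u i)]
  refine Finset.sum_congr rfl fun j _ => ?_
  rw [permMarginal, Finset.mul_sum]
  refine Finset.sum_congr rfl fun u hu => ?_
  rw [(Finset.mem_filter.1 hu).2, mul_comm]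

lemma permMarginal_nonneg {A : Finset (Equiv.Perm (Fin n))} {w : Equiv.Perm (Fin n) → ℝ}
    (hw : ∀ u ∈ A, 0 ≤ w u) (i j : Fin n) : 0 ≤ permMarginal A w i j :=
  Finset.sum_nonneg fun u hu => hw u (Finset.mem_filter.1 hu).1

lemma permMarginal_le_one {A : Finset (Equiv.Perm (Fin n))} {w : Equiv.Perm (Fin n) → ℝ}
    (hw : ∀ u ∈ A, 0 ≤ w u) (hw1 : ∑ u ∈ A, w u = 1) (i j : Fin n) : permMarginal A w i j ≤ 1 := by
  rw [← hw1]
  exact Finset.sum_le_sum_of_subset_of_nonneg (Finset.filter_subset _ _) fun u hu _ => hw u hu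

/-- Forgetting bijectivity enlarges the sum to all maps `Fin n → Fin n`, where it factors into row
sums. -/
lemma sum_perm_prod_le_one (A : Finset (Equiv.Perm (Fin n))) {ν : Fin n → Fin n → ℝ}
    (h0 : ∀ i j, 0 ≤ ν i j) (h1 : ∀ i, ∑ j, ν i j ≤ 1) : ∑ u ∈ A, ∏ i, ν i (u i) ≤ 1 := by
  classical
  have hinj : Function.Injective (fun u : Equiv.Perm (Fin n) => (u : Fin n → Fin n)) :=
    DFunLike.coe_injective
  calc ∑ u ∈ A, ∏ i, ν i (u i)
      = ∑ v ∈ A.image (fun u : Equiv.Perm (Fin n) => (u : Fin n → Fin n)), ∏ i, ν i (v i) := by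
        rw [Finset.sum_image fun a _ b _ h => hinj h]
    _ ≤ ∑ v : Fin n → Fin n, ∏ i, ν i (v i) :=
        Finset.sum_le_sum_of_subset_of_nonneg (Finset.subset_univ _)
          fun v _ _ => Finset.prod_nonneg fun i _ => h0 i _
    _ = ∏ i, ∑ j, ν i j := by
        rw [Finset.prod_univ_sum, Fintype.piFinset_univ]
    _ ≤ 1 := Finset.prod_le_one (fun i _ => Finset.sum_nonneg fun j _ => h0 i j) fun i _ => h1 i

/-- Entropy of a random permutation, bounded by the uncertainty of its values. -/
lemma sum_neg_mul_log_le (hn : 1 ≤ n) {A : Finset (Equiv.Perm (Fin n))}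
    {w : Equiv.Perm (Fin n) → ℝ} (hw : ∀ u ∈ A, 0 < w u) (hw1 : ∑ u ∈ A, w u = 1) :
    ∑ u ∈ A, -(w u * Real.log (w u)) ≤
      Real.log (n * (n + 1)) *
        (∑ i, ∑ j, permMarginal A w i j * (1 - permMarginal A w i j)) + 1 := by
  have hn0 : (0 : ℝ) < n := by exact_mod_cast hn
  set f := permMarginal A w with hf
  have hf0 : ∀ i j, 0 ≤ f i j := permMarginal_nonneg fun u hu => (hw u hu).le
  have hf1 : ∀ i j, f i j ≤ 1 := permMarginal_le_one (fun u hu => (hw u hu).le) hw1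
  have hfs : ∀ i, ∑ j, f i j = 1 := fun i => (sum_permMarginal A w i).trans hw1
  set a : ℝ := 1 / (n * (n + 1)) with ha
  set b : ℝ := n / (n + 1) with hb
  have ha0 : 0 < a := by positivity
  have hb0 : 0 < b := by positivity
  set ν : Fin n → Fin n → ℝ := fun i j => (1 - f i j) * a + f i j * b with hν
  have hν0 : ∀ i j, 0 < ν i j := by
    intro i j
    rcases (hf0 i j).eq_or_lt with h | h
    · simp [hν, ← h, ha0]
    · have := mul_pos h hb0
      have := mul_nonneg (sub_nonneg.2 (hf1 i j)) ha0.le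
      simp only [hν]; linarith
  have hνs : ∀ i, ∑ j, ν i j ≤ 1 := by
    intro i
    have : ∑ j, ν i j = (n - 1) * a + b := by
      simp only [hν, sub_mul, Finset.sum_add_distrib, Finset.sum_sub_distrib, ← Finset.sum_mul,
        hfs]
      simp
    rw [this, ha, hb, ← sub_nonneg]
    have : 1 - ((n - 1) * (1 / ((n : ℝ) * (n + 1))) + n / (n + 1)) = 1 / (n * (n + 1)) := by
      field_simp; ring
    rw [this]; positivity
  -- Concavity of `log` between `a` and `b`; the weight `1 - f` is what produces `f (1 - f)` after
  -- averaging.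
  have hlog : ∀ i j, -Real.log (ν i j) ≤ (1 - f i j) * Real.log (n * (n + 1)) + f i j * (1 / n) := by
    intro i j
    have h := strictConcaveOn_log_Ioi.concaveOn.2 (Set.mem_Ioi.2 ha0) (Set.mem_Ioi.2 hb0)
      (sub_nonneg.2 (hf1 i j)) (hf0 i j) (by ring)
    simp only [smul_eq_mul] at h
    have hla : Real.log a = -Real.log (n * (n + 1)) := by
      rw [ha, one_div, Real.log_inv]
    have hlb : -(1 / (n : ℝ)) ≤ Real.log b := by
      have h2 := Real.one_sub_inv_le_log_of_pos hb0
      have : 1 - b⁻¹ = -(1 / (n : ℝ)) := by rw [hb]; field_simp; ring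
      linarith
    have h3 := mul_le_mul_of_nonneg_left hlb (hf0 i j)
    rw [hla] at h
    simp only [hν]
    linarith
  have hprod : ∀ u : Equiv.Perm (Fin n), 0 < ∏ i, ν i (u i) :=
    fun u => Finset.prod_pos fun i _ => hν0 i _
  -- Gibbs' inequality
  have hgibbs : ∑ u ∈ A, -(w u * Real.log (w u)) ≤
      ∑ u ∈ A, w u * ∑ i, -Real.log (ν i (u i)) := by
    rw [← sub_nonpos, ← Finset.sum_sub_distrib]
    calc _ ≤ ∑ u ∈ A, (∏ i, ν i (u i) - w u) := by
          refine Finset.sum_le_sum fun u hu => ?_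
          have h1 := Real.log_le_sub_one_of_pos (div_pos (hprod u) (hw u hu))
          rw [Real.log_div (hprod u).ne' (hw u hu).ne',
            Real.log_prod (fun i _ => (hν0 i (u i)).ne')] at h1
          have h2 := mul_le_mul_of_nonneg_left h1 (hw u hu).le
          have h3 : w u * ((∏ i, ν i (u i)) / w u - 1) = ∏ i, ν i (u i) - w u := by
            have := (hw u hu).ne'
            field_simp
          rw [h3] at h2
          rw [Finset.sum_neg_distrib]
          linarith
      _ ≤ 0 := by
          rw [Finset.sum_sub_distrib, hw1]
          linarith [sum_perm_prod_le_one A (fun i j => (hν0 i j).le) hνs]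
  refine hgibbs.trans ?_
  rw [← sum_mul_permMarginal A w fun i j => -Real.log (ν i j)]
  calc ∑ i, ∑ j, -Real.log (ν i j) * f i j
      ≤ ∑ i, ∑ j, (Real.log (n * (n + 1)) * (f i j * (1 - f i j)) + f i j * (1 / n)) := by
        refine Finset.sum_le_sum fun i _ => Finset.sum_le_sum fun j _ => ?_
        have h1 := mul_le_mul_of_nonneg_right (hlog i j) (hf0 i j)
        -- The remaining terms `f / n` add up to `1` over all pairs, which is the additive constant.
        have h2 : f i j * f i j * (1 / n) ≤ 1 * f i j * (1 / n) := by
          gcongr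
          · exact hf0 i j
          · exact hf1 i j
        linarith
    _ = _ := by
        simp only [Finset.sum_add_distrib, ← Finset.mul_sum, ← Finset.sum_mul, hfs]
        simp
        field_simp

end Entropy

/-! ### Gibbs measures, and the width of a set of permutations. -/

section Width

variable {n : ℕ}

/-- The Gibbs weights of the assignment field on `A` at inverse temperature `β`. -/
noncomputable def gibbsWeight (A : Finset (Equiv.Perm (Fin n))) (β : ℝ)
    (x : Fin n × Fin n → ℝ) (u : Equiv.Perm (Fin n)) : ℝ :=
  Real.exp (β * assignmentDual n u x) / ∑ v ∈ A, Real.exp (β * assignmentDual n v x)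

variable {A : Finset (Equiv.Perm (Fin n))}

lemma sum_exp_assignmentDual_pos (hA : A.Nonempty) (β : ℝ) (x : Fin n × Fin n → ℝ) :
    0 < ∑ v ∈ A, Real.exp (β * assignmentDual n v x) :=
  Finset.sum_pos (fun _ _ => Real.exp_pos _) hA

lemma gibbsWeight_pos (hA : A.Nonempty) (β : ℝ) (x : Fin n × Fin n → ℝ)
    (u : Equiv.Perm (Fin n)) : 0 < gibbsWeight A β x u :=
  div_pos (Real.exp_pos _) (sum_exp_assignmentDual_pos hA β x)

lemma sum_gibbsWeight (hA : A.Nonempty) (β : ℝ) (x : Fin n × Fin n → ℝ) :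
    ∑ u ∈ A, gibbsWeight A β x u = 1 := by
  unfold gibbsWeight
  rw [← Finset.sum_div, div_self (sum_exp_assignmentDual_pos hA β x).ne']

/-- The Gibbs marginals of the assignment field. -/
noncomputable def gibbsMarginal (A : Finset (Equiv.Perm (Fin n))) (β : ℝ) (i j : Fin n)
    (x : Fin n × Fin n → ℝ) : ℝ :=
  permMarginal A (gibbsWeight A β x) i j

lemma continuous_gibbsMarginal (hA : A.Nonempty) (β : ℝ) (i j : Fin n) :
    Continuous (gibbsMarginal A β i j) := by
  unfold gibbsMarginal permMarginal gibbsWeight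
  refine continuous_finsetSum _ fun u _ => ?_
  refine Continuous.div (by fun_prop) (by fun_prop) fun x => ?_
  exact (sum_exp_assignmentDual_pos hA β x).ne'

lemma gibbsMarginal_nonneg (hA : A.Nonempty) (β : ℝ) (i j : Fin n) (x : Fin n × Fin n → ℝ) :
    0 ≤ gibbsMarginal A β i j x :=
  permMarginal_nonneg (fun u _ => (gibbsWeight_pos hA β x u).le) i j

lemma gibbsMarginal_le_one (hA : A.Nonempty) (β : ℝ) (i j : Fin n) (x : Fin n × Fin n → ℝ) :
    gibbsMarginal A β i j x ≤ 1 :=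
  permMarginal_le_one (fun u _ => (gibbsWeight_pos hA β x u).le) (sum_gibbsWeight hA β x) i j

/-- Isolates the dependence on one entry: only permutations through `(i, j)` see it, and all of them
shift equally. -/
lemma assignmentDual_update (u : Equiv.Perm (Fin n)) (x : Fin n × Fin n → ℝ) (i j : Fin n)
    (t : ℝ) : assignmentDual n u (Function.update x (i, j) t) =
      assignmentDual n u (Function.update x (i, j) 0) + if u i = j then t / √(n : ℝ) else 0 := by
  simp only [assignmentDual_apply]
  rw [← Finset.add_sum_erase _ _ (Finset.mem_univ i), ← Finset.add_sum_erase _ (fun k =>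
    Function.update x (i, j) 0 (k, u k)) (Finset.mem_univ i)]
  have h : ∀ s : ℝ, ∑ k ∈ Finset.univ.erase i, Function.update x (i, j) s (k, u k) =
      ∑ k ∈ Finset.univ.erase i, x (k, u k) := by
    intro s
    refine Finset.sum_congr rfl fun k hk => ?_
    rw [Function.update_of_ne]
    intro h
    exact Finset.ne_of_mem_erase hk (Prod.mk.inj h).1
  rw [h, h]
  split_ifs with hij
  · subst hij
    simp; ring
  · have hne : (i, u i) ≠ (i, j) := fun h => hij (Prod.mk.inj h).2
    simp [Function.update_of_ne hne]

lemma gibbsMarginal_eq_div (A : Finset (Equiv.Perm (Fin n))) (β : ℝ) (i j : Fin n)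
    (x : Fin n × Fin n → ℝ) :
    gibbsMarginal A β i j x = (∑ u ∈ A with u i = j, Real.exp (β * assignmentDual n u x)) /
      (∑ u ∈ A, Real.exp (β * assignmentDual n u x)) := by
  simp [gibbsMarginal, permMarginal, gibbsWeight, Finset.sum_div]

/-- As a function of its own entry the marginal is logistic, `a e^{κt} / (a e^{κt} + d)` with `κ = β
/ √n`, hence the derivative `κ f (1 - f)`. -/
lemma hasDerivAt_gibbsMarginal_update (hA : A.Nonempty) (β : ℝ) (i j : Fin n)
    (x : Fin n × Fin n → ℝ) (t : ℝ) :
    HasDerivAt (fun t => gibbsMarginal A β i j (Function.update x (i, j) t))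
      (β / √(n : ℝ) * (gibbsMarginal A β i j (Function.update x (i, j) t) *
        (1 - gibbsMarginal A β i j (Function.update x (i, j) t)))) t := by
  set κ := β / √(n : ℝ) with hκ
  set a := ∑ u ∈ A with u i = j, Real.exp (β * assignmentDual n u (Function.update x (i, j) 0))
  set d := ∑ u ∈ A with ¬ u i = j, Real.exp (β * assignmentDual n u (Function.update x (i, j) 0))
  have hnum : ∀ t, ∑ u ∈ A with u i = j,
      Real.exp (β * assignmentDual n u (Function.update x (i, j) t)) = a * Real.exp (κ * t) := by
    intro t
    rw [Finset.sum_mul]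
    refine Finset.sum_congr rfl fun u hu => ?_
    rw [assignmentDual_update, if_pos (Finset.mem_filter.1 hu).2, ← Real.exp_add, hκ]
    congr 1; ring
  have hden : ∀ t, ∑ u ∈ A,
      Real.exp (β * assignmentDual n u (Function.update x (i, j) t)) =
        a * Real.exp (κ * t) + d := by
    intro t
    rw [← Finset.sum_filter_add_sum_filter_not A (fun u => u i = j), hnum]
    congr 1
    refine Finset.sum_congr rfl fun u hu => ?_
    rw [assignmentDual_update, if_neg (Finset.mem_filter.1 hu).2, add_zero]
  have hpos : a * Real.exp (κ * t) + d ≠ 0 := by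
    rw [← hden]; exact (sum_exp_assignmentDual_pos hA β _).ne'
  simp_rw [gibbsMarginal_eq_div, hnum, hden]
  have h1 : HasDerivAt (fun t => a * Real.exp (κ * t)) (a * (Real.exp (κ * t) * κ)) t := by
    have := (((hasDerivAt_id t).const_mul κ).exp).const_mul a
    simpa using this
  refine (h1.div (h1.add_const d) hpos).congr_deriv ?_
  field_simp

/-- The expected energy of the Gibbs measure, by integration by parts. -/
lemma integral_gibbs_energy (hn : 1 ≤ n) (hA : A.Nonempty) (β : ℝ) :
    ∫ x, ∑ u ∈ A, gibbsWeight A β x u * assignmentDual n u x ∂(stdGaussianPi (Fin n × Fin n)) =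
      β / n * ∫ x, ∑ i, ∑ j, gibbsMarginal A β i j x * (1 - gibbsMarginal A β i j x)
        ∂(stdGaussianPi (Fin n × Fin n)) := by
  have hn0 : (0 : ℝ) < n := by exact_mod_cast hn
  have hc := fun i j => continuous_gibbsMarginal (n := n) hA β i j
  have h0 := gibbsMarginal_nonneg (n := n) hA β
  have h1 := gibbsMarginal_le_one (n := n) hA β
  have hb : ∀ i j x, |gibbsMarginal A β i j x| ≤ 1 := fun i j x =>
    abs_le.2 ⟨by linarith [h0 i j x], h1 i j x⟩
  have hb' : ∀ i j x, |gibbsMarginal A β i j x * (1 - gibbsMarginal A β i j x)| ≤ 1 := by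
    intro i j x
    rw [abs_of_nonneg (mul_nonneg (h0 i j x) (by linarith [h1 i j x]))]
    nlinarith [h0 i j x, h1 i j x]
  have hxi : ∀ i j, Integrable (fun x : Fin n × Fin n → ℝ => x (i, j) * gibbsMarginal A β i j x)
      (stdGaussianPi (Fin n × Fin n)) := fun i j =>
    (integrable_eval_stdGaussianPi (i, j)).mul_bdd (hc i j).aestronglyMeasurable
      (ae_of_all _ (hb i j))
  have hfi : ∀ i j, Integrable (fun x => gibbsMarginal A β i j x * (1 - gibbsMarginal A β i j x))
      (stdGaussianPi (Fin n × Fin n)) := fun i j =>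
    Integrable.of_bound ((hc i j).mul (continuous_const.sub (hc i j))).aestronglyMeasurable 1
      (ae_of_all _ (hb' i j))
  have henergy : ∀ x, ∑ u ∈ A, gibbsWeight A β x u * assignmentDual n u x =
      1 / √(n : ℝ) * ∑ i, ∑ j, x (i, j) * gibbsMarginal A β i j x := by
    intro x
    unfold gibbsMarginal
    rw [sum_mul_permMarginal A (gibbsWeight A β x) fun i j => x (i, j), Finset.mul_sum]
    refine Finset.sum_congr rfl fun u _ => ?_
    rw [assignmentDual_apply]; ring
  have hibp : ∀ i j, ∫ x, x (i, j) * gibbsMarginal A β i j x ∂(stdGaussianPi (Fin n × Fin n)) =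
      β / √(n : ℝ) * ∫ x, gibbsMarginal A β i j x * (1 - gibbsMarginal A β i j x)
        ∂(stdGaussianPi (Fin n × Fin n)) := by
    intro i j
    rw [integral_eval_mul_stdGaussianPi (i, j)
      (f' := fun x => β / √(n : ℝ) * (gibbsMarginal A β i j x * (1 - gibbsMarginal A β i j x)))
      (C := 1) (C' := |β / √(n : ℝ)|)
      (hasDerivAt_gibbsMarginal_update hA β i j) (hc i j)
      (continuous_const.mul ((hc i j).mul (continuous_const.sub (hc i j)))) (hb i j)
      (fun x => by
        rw [abs_mul]
        exact mul_le_of_le_one_right (abs_nonneg _) (hb' i j x)), integral_const_mul]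
  simp_rw [henergy]
  rw [integral_const_mul, integral_finsetSum _ fun i _ => integrable_finsetSum _ fun j _ => hxi i j,
    integral_finsetSum _ fun i _ => integrable_finsetSum _ fun j _ => hfi i j]
  simp_rw [integral_finsetSum _ fun j _ => hxi _ j, integral_finsetSum _ fun j _ => hfi _ j, hibp,
    ← Finset.mul_sum]
  rw [← mul_assoc]
  congr 1
  rw [one_div, inv_mul_eq_div, div_div, Real.mul_self_sqrt hn0.le]

/-- Pointwise comparison of `log |A|` with the Gibbs energy and the entropy of the marginals. -/
lemma log_card_le_energy_add (hn : 1 ≤ n) (hA : A.Nonempty) (β : ℝ) (x : Fin n × Fin n → ℝ) :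
    Real.log A.card + β * ((∑ u ∈ A, assignmentDual n u x) / A.card) ≤
      β * (∑ u ∈ A, gibbsWeight A β x u * assignmentDual n u x) +
      (Real.log (n * (n + 1)) *
        (∑ i, ∑ j, gibbsMarginal A β i j x * (1 - gibbsMarginal A β i j x)) + 1) := by
  have hent := sum_neg_mul_log_le hn (fun u _ => gibbsWeight_pos hA β x u) (sum_gibbsWeight hA β x)
  have hZ := sum_exp_assignmentDual_pos hA β x
  have hcard : (0 : ℝ) < A.card := by exact_mod_cast hA.card_pos
  set Z := ∑ v ∈ A, Real.exp (β * assignmentDual n v x) with hZdef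
  have hlogw : ∀ u, Real.log (gibbsWeight A β x u) = β * assignmentDual n u x - Real.log Z := by
    intro u
    rw [gibbsWeight, Real.log_div (Real.exp_pos _).ne' hZ.ne', Real.log_exp]
  have h1 : ∑ u ∈ A, -(gibbsWeight A β x u * Real.log (gibbsWeight A β x u)) =
      Real.log Z - β * ∑ u ∈ A, gibbsWeight A β x u * assignmentDual n u x := by
    simp_rw [hlogw]
    have h := congrArg (· * Real.log Z) (sum_gibbsWeight hA β x)
    simp only [one_mul, Finset.sum_mul] at h
    conv_rhs => rw [← h, Finset.mul_sum, ← Finset.sum_sub_distrib]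
    exact Finset.sum_congr rfl fun u _ => by ring
  -- Jensen's inequality for `exp` under the uniform law on `A`. The average kept on the left
  -- integrates to zero over the Gaussian costs.
  have h2 : Real.log A.card + β * ((∑ u ∈ A, assignmentDual n u x) / A.card) ≤ Real.log Z := by
    have hj := convexOn_exp.map_sum_le (t := A) (w := fun _ => (1 : ℝ) / A.card)
      (p := fun u => β * assignmentDual n u x) (fun _ _ => by positivity)
      (by simp [hcard.ne']) (fun _ _ => Set.mem_univ _)
    simp only [smul_eq_mul, ← Finset.mul_sum] at hj
    rw [← hZdef] at hj
    rw [Real.le_log_iff_exp_le hZ, Real.exp_add, Real.exp_log hcard]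
    have h3 : 1 / (A.card : ℝ) * (β * ∑ u ∈ A, assignmentDual n u x) =
      β * ((∑ u ∈ A, assignmentDual n u x) / A.card) := by ring
    rw [h3] at hj
    calc _ ≤ (A.card : ℝ) * (1 / A.card * Z) := by gcongr
      _ = Z := by field_simp
  unfold gibbsMarginal
  rw [h1] at hent
  linarith

/-- The mean maximum of the assignment field over a set `A` of permutations. -/
noncomputable def assignmentWidth (A : Finset (Equiv.Perm (Fin n))) (hA : A.Nonempty) : ℝ :=
  ∫ x, A.sup' hA (fun u => assignmentDual n u x) ∂(stdGaussianPi (Fin n × Fin n))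

lemma integrable_assignmentDual (hn : 1 ≤ n) (u : Equiv.Perm (Fin n)) :
    Integrable (fun x => assignmentDual n u x) (stdGaussianPi (Fin n × Fin n)) :=
  integrable_of_map_eq (map_assignmentDual hn) u

lemma integrable_sup'_assignmentDual (hn : 1 ≤ n) (hA : A.Nonempty) :
    Integrable (fun x => A.sup' hA (fun u => assignmentDual n u x))
      (stdGaussianPi (Fin n × Fin n)) := by
  have hm : Measurable (fun x => A.sup' hA (fun u => assignmentDual n u x)) := by
    have := Finset.measurable_sup' (s := A) hA
      (f := fun u x => assignmentDual n u x) (fun u _ => by fun_prop)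
    convert this using 1
    ext x
    simp [Finset.sup'_apply]
  refine Integrable.mono' (g := fun x => ∑ u ∈ A, |assignmentDual n u x|)
    (integrable_finsetSum _ fun u _ => (integrable_assignmentDual hn u).abs)
    hm.aestronglyMeasurable (ae_of_all _ fun x => ?_)
  obtain ⟨u, hu, h⟩ := Finset.exists_mem_eq_sup' hA (fun u => assignmentDual n u x)
  rw [h]
  exact Finset.single_le_sum (f := fun u => |assignmentDual n u x|) (fun _ _ => abs_nonneg _) hu

/-- A large set of permutations has large width. -/
lemma log_card_le_assignmentWidth (hn : 2 ≤ n) (hA : A.Nonempty) :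
    Real.log A.card ≤ 4 * √(n * Real.log n) * assignmentWidth A hA + 1 := by
  have hn1 : 1 ≤ n := by omega
  have hn0 : (0 : ℝ) < n := by exact_mod_cast hn1
  have hn2 : (2 : ℝ) ≤ n := by exact_mod_cast hn
  have hlog : 0 < Real.log n := Real.log_pos (by linarith)
  -- This choice balances the energy term `β V` against the entropy term `3 n log n · V / β`; they
  -- become `β V` and `3 β V`, whence the factor `4`.
  set β := √(n * Real.log n) with hβ
  have hβ0 : 0 < β := by positivity
  have hβ2 : β ^ 2 = n * Real.log n := Real.sq_sqrt (by positivity)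
  have hl0 : 0 ≤ Real.log (n * (n + 1)) := Real.log_nonneg (by nlinarith)
  have hl : Real.log (n * (n + 1)) ≤ 3 * Real.log n := by
    rw [show (3 : ℝ) * Real.log n = Real.log ((n : ℝ) ^ 3) by rw [Real.log_pow]; norm_num]
    refine Real.log_le_log (by positivity) ?_
    nlinarith [mul_nonneg hn0.le (sub_nonneg.2 hn2)]
  set γ := stdGaussianPi (Fin n × Fin n) with hγ
  have hW := integrable_sup'_assignmentDual hn1 hA
  have hEle : ∀ x, ∑ u ∈ A, gibbsWeight A β x u * assignmentDual n u x ≤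
      A.sup' hA (fun u => assignmentDual n u x) := by
    intro x
    rw [← one_mul (A.sup' hA _), ← sum_gibbsWeight hA β x, Finset.sum_mul]
    exact Finset.sum_le_sum fun u hu => mul_le_mul_of_nonneg_left
      (Finset.le_sup' (fun u => assignmentDual n u x) hu) (gibbsWeight_pos hA β x u).le
  have hE : Integrable (fun x => ∑ u ∈ A, gibbsWeight A β x u * assignmentDual n u x) γ := by
    refine integrable_finsetSum _ fun u hu => (integrable_assignmentDual hn1 u).bdd_mul (c := 1)
      ?_ (ae_of_all _ fun x => ?_)
    · unfold gibbsWeight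
      exact Measurable.aestronglyMeasurable (by fun_prop)
    · rw [Real.norm_eq_abs, abs_of_pos (gibbsWeight_pos hA β x u), ← sum_gibbsWeight hA β x]
      exact Finset.single_le_sum (f := fun u => gibbsWeight A β x u)
        (fun v _ => (gibbsWeight_pos hA β x v).le) hu
  set T : (Fin n × Fin n → ℝ) → ℝ := fun x =>
    ∑ i, ∑ j, gibbsMarginal A β i j x * (1 - gibbsMarginal A β i j x) with hTdef
  have hT : Integrable T γ := by
    refine integrable_finsetSum _ fun i _ => integrable_finsetSum _ fun j _ => ?_
    have hc := continuous_gibbsMarginal hA β i j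
    refine Integrable.of_bound (hc.mul (continuous_const.sub hc)).aestronglyMeasurable 1
      (ae_of_all _ fun x => ?_)
    have h0 := gibbsMarginal_nonneg hA β i j x
    have h1 := gibbsMarginal_le_one hA β i j x
    rw [Real.norm_eq_abs, abs_of_nonneg (mul_nonneg h0 (by linarith))]
    nlinarith
  have hT0 : 0 ≤ ∫ x, T x ∂γ := integral_nonneg fun x =>
    Finset.sum_nonneg fun i _ => Finset.sum_nonneg fun j _ =>
      mul_nonneg (gibbsMarginal_nonneg hA β i j x) (sub_nonneg.2 (gibbsMarginal_le_one hA β i j x))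
  have henergy := integral_gibbs_energy hn1 hA β
  set V := ∫ x, ∑ u ∈ A, gibbsWeight A β x u * assignmentDual n u x ∂γ with hV
  have hVW : V ≤ assignmentWidth A hA := integral_mono hE hW hEle
  have hsum : Integrable (fun x => ∑ u ∈ A, assignmentDual n u x) γ :=
    integrable_finsetSum _ fun u _ => integrable_assignmentDual hn1 u
  have hsum0 : ∫ x, ∑ u ∈ A, assignmentDual n u x ∂γ = 0 := by
    rw [integral_finsetSum _ fun u _ => integrable_assignmentDual hn1 u]
    exact Finset.sum_eq_zero fun u _ => integral_strongDual_stdGaussianPi _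
  have hmain : Real.log A.card ≤ β * V + (Real.log (n * (n + 1)) * (∫ x, T x ∂γ) + 1) := by
    have hlhs : Integrable (fun x => Real.log A.card +
        β * ((∑ u ∈ A, assignmentDual n u x) / A.card)) γ :=
      (integrable_const _).add ((hsum.div_const _).const_mul _)
    have hrhs2 : Integrable (fun x => Real.log (n * (n + 1)) * T x + 1) γ :=
      (hT.const_mul _).add (integrable_const _)
    have h := integral_mono hlhs ((hE.const_mul β).add hrhs2) (log_card_le_energy_add hn1 hA β)
    simp only [Pi.add_apply] at h
    rw [integral_add (integrable_const _) ((hsum.div_const _).const_mul _),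
      integral_add (hE.const_mul β) hrhs2,
      integral_add (hT.const_mul _) (integrable_const _), integral_const_mul, integral_div, hsum0,
      integral_const_mul, integral_const_mul] at h
    simpa using h
  have hVT : ∫ x, T x ∂γ = n * V / β := by
    rw [henergy]; field_simp; rfl
  have hV0 : 0 ≤ V := by
    rw [henergy]; exact mul_nonneg (by positivity) hT0
  have h3 : Real.log (n * (n + 1)) * (∫ x, T x ∂γ) ≤ 3 * β * V := by
    calc _ ≤ 3 * Real.log n * ∫ x, T x ∂γ := by gcongr
      _ = 3 * (n * Real.log n) * V / β := by rw [hVT]; ring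
      _ = _ := by rw [← hβ2]; field_simp
  have h4 : β * V ≤ β * assignmentWidth A hA := by gcongr
  linarith

end Width

/-! ### Elementary bounds and measurability for the log-cardinality. -/

section LogCard

variable {Ω ι : Type*} [MeasurableSpace Ω] [Fintype ι] [Nonempty ι]

/-- The indicator is redundant because `Real.log 0 = 0`. -/
lemma logCardNearMaximal_eq_log_card (P : Measure Ω) (g : ι → Ω → ℝ) (ε : ℝ) (ω : Ω) :
    logCardNearMaximal P g ε ω = Real.log ((nearMaximalSet P g ε ω).card : ℝ) := by
  unfold logCardNearMaximal
  by_cases h : (nearMaximalSet P g ε ω).Nonempty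
  · rw [Set.indicator_of_mem (show ω ∈ {ω | (nearMaximalSet P g ε ω).Nonempty} from h)]
  · rw [Set.indicator_of_notMem (show ω ∉ {ω | (nearMaximalSet P g ε ω).Nonempty} from h),
      Finset.not_nonempty_iff_eq_empty.1 h]
    simp

lemma logCardNearMaximal_nonneg (P : Measure Ω) (g : ι → Ω → ℝ) (ε : ℝ) (ω : Ω) :
    0 ≤ logCardNearMaximal P g ε ω := by
  rw [logCardNearMaximal_eq_log_card]
  exact Real.log_natCast_nonneg _

lemma logCardNearMaximal_le (P : Measure Ω) (g : ι → Ω → ℝ) (ε : ℝ) (ω : Ω) :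
    logCardNearMaximal P g ε ω ≤ Real.log (Fintype.card ι) := by
  rw [logCardNearMaximal_eq_log_card]
  rcases (nearMaximalSet P g ε ω).card.eq_zero_or_pos with h | h
  · rw [h]; simpa using Real.log_natCast_nonneg _
  · exact Real.log_le_log (by exact_mod_cast h) (by exact_mod_cast Finset.card_le_univ _)

lemma measurable_logCardNearMaximal (P : Measure Ω) {g : ι → Ω → ℝ} (hg : ∀ u, Measurable (g u))
    (ε : ℝ) : Measurable (logCardNearMaximal P g ε) := by
  have h : logCardNearMaximal P g ε = fun ω => Real.log (∑ u,
      if g u ω > (1 - ε) * ∫ ω', fieldMax g ω' ∂P then (1 : ℝ) else 0) := by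
    ext ω
    rw [logCardNearMaximal_eq_log_card, nearMaximalSet, Finset.sum_boole]
  rw [h]
  refine Real.measurable_log.comp (Finset.measurable_sum _ fun u _ => ?_)
  exact Measurable.ite (measurableSet_lt measurable_const (hg u)) measurable_const measurable_const

lemma integrable_logCardNearMaximal (P : Measure Ω) [IsFiniteMeasure P] {g : ι → Ω → ℝ}
    (hg : ∀ u, Measurable (g u)) (ε : ℝ) : Integrable (logCardNearMaximal P g ε) P := by
  refine Integrable.of_bound (measurable_logCardNearMaximal P hg ε).aestronglyMeasurable
    (Real.log (Fintype.card ι)) (ae_of_all _ fun ω => ?_)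
  rw [Real.norm_eq_abs, abs_of_nonneg (logCardNearMaximal_nonneg P g ε ω)]
  exact logCardNearMaximal_le P g ε ω

end LogCard

/-! ### The perturbation argument and the choice of its strength. -/

section NearMaximal

variable {n : ℕ}

/-- The random variable `log |A(ε)|` on the canonical space of cost matrices. -/
noncomputable def canonicalLogCard (n : ℕ) (ε : ℝ) : (Fin n × Fin n → ℝ) → ℝ :=
  logCardNearMaximal (stdGaussianPi (Fin n × Fin n)) (fun u x => assignmentDual n u x) ε

/-- The mean of the maximum of the assignment field. -/
noncomputable def meanMax (n : ℕ) : ℝ :=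
  ∫ x, dualMax (assignmentDual n) x ∂(stdGaussianPi (Fin n × Fin n))

lemma integrable_canonicalLogCard (ε : ℝ) :
    Integrable (canonicalLogCard n ε) (stdGaussianPi (Fin n × Fin n)) :=
  integrable_logCardNearMaximal _ (fun u => by fun_prop) ε

lemma meanMax_nonneg (hn : 1 ≤ n) : 0 ≤ meanMax n :=
  integral_dualMax_nonneg (map_assignmentDual hn)

lemma log_factorial_le (n : ℕ) : Real.log (n.factorial : ℝ) ≤ n * Real.log n := by
  rw [← Real.log_pow]
  exact Real.log_le_log (by exact_mod_cast n.factorial_pos) (by exact_mod_cast n.factorial_le_pow)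

lemma meanMax_le (hn : 2 ≤ n) : meanMax n ≤ 2 * √(n * Real.log n) := by
  have hn2 : (2 : ℝ) ≤ n := by exact_mod_cast hn
  have hL : 0 < n * Real.log n := mul_pos (by linarith) (Real.log_pos (by linarith))
  have hs : 0 < √(n * Real.log n) := Real.sqrt_pos.2 hL
  have h := integral_dualMax_le (map_assignmentDual (n := n) (by omega)) hs
  rw [Fintype.card_perm, Fintype.card_fin] at h
  have h2 : Real.log (n.factorial : ℝ) / √(n * Real.log n) ≤ √(n * Real.log n) := by
    rw [div_le_iff₀ hs, Real.mul_self_sqrt hL.le]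
    exact log_factorial_le n
  unfold meanMax
  linarith

lemma integrable_dualMax_translate (hn : 1 ≤ n) (s : ℝ) (x : Fin n × Fin n → ℝ) :
    Integrable (fun y => dualMax (assignmentDual n) (x + s • y))
      (stdGaussianPi (Fin n × Fin n)) := by
  refine integrable_fieldMax (g := fun u y => assignmentDual n u (x + s • y))
    (fun u => by fun_prop) fun u => ?_
  simp only [map_add, map_smul, smul_eq_mul]
  exact (integrable_const _).add ((integrable_assignmentDual hn u).const_mul _)

/-- Perturbing the costs raises the maximum in proportion to the width of the near-maximal set. -/
lemma le_integral_dualMax_translate (hn : 2 ≤ n) {s ε : ℝ} (hs : 0 < s) (hε : 0 ≤ ε)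
    (x : Fin n × Fin n → ℝ) :
    s * ((canonicalLogCard n ε x - 1) / (4 * √(n * Real.log n))) +
      min (dualMax (assignmentDual n) x) (meanMax n) - ε * meanMax n ≤
    ∫ y, dualMax (assignmentDual n) (x + s • y) ∂(stdGaussianPi (Fin n × Fin n)) := by
  have hn1 : 1 ≤ n := by omega
  have hn2 : (2 : ℝ) ≤ n := by exact_mod_cast hn
  have hL : 0 < n * Real.log n := mul_pos (by linarith) (Real.log_pos (by linarith))
  have hr : 0 < √(n * Real.log n) := Real.sqrt_pos.2 hL
  have hm := meanMax_nonneg hn1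
  have hint := integrable_dualMax_translate hn1 s x
  set γ := stdGaussianPi (Fin n × Fin n)
  set A := nearMaximalSet γ (fun u x => assignmentDual n u x) ε x with hAdef
  have hH : canonicalLogCard n ε x = Real.log A.card := logCardNearMaximal_eq_log_card _ _ _ _
  have hle : ∀ u y, assignmentDual n u x + s * assignmentDual n u y ≤
      dualMax (assignmentDual n) (x + s • y) := by
    intro u y
    have : assignmentDual n u (x + s • y) ≤ dualMax (assignmentDual n) (x + s • y) :=
      le_fieldMax (fun u x => assignmentDual n u x) u (x + s • y)
    simpa only [map_add, map_smul, smul_eq_mul] using this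
  by_cases hA : A.Nonempty
  · have hW := integrable_sup'_assignmentDual hn1 hA
    have h1 : (1 - ε) * meanMax n + s * assignmentWidth A hA ≤
        ∫ y, dualMax (assignmentDual n) (x + s • y) ∂γ := by
      have h2 : ∫ y, ((1 - ε) * meanMax n + s * A.sup' hA (fun u => assignmentDual n u y)) ∂γ =
          (1 - ε) * meanMax n + s * assignmentWidth A hA := by
        rw [integral_add (integrable_const _) (hW.const_mul s), integral_const,
          probReal_univ, one_smul, integral_const_mul, assignmentWidth]
      rw [← h2]
      refine integral_mono ((integrable_const _).add (hW.const_mul s)) hint fun y => ?_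
      obtain ⟨u, hu, h⟩ := Finset.exists_mem_eq_sup' hA (fun u => assignmentDual n u y)
      beta_reduce
      rw [h]
      have h3 : (1 - ε) * meanMax n < assignmentDual n u x := (Finset.mem_filter.1 hu).2
      linarith [hle u y]
    have h4 := log_card_le_assignmentWidth hn hA
    have h5 : (canonicalLogCard n ε x - 1) / (4 * √(n * Real.log n)) ≤ assignmentWidth A hA := by
      rw [div_le_iff₀ (by positivity), hH]; linarith
    have h6 := mul_le_mul_of_nonneg_left h5 hs.le
    have h7 := min_le_right (dualMax (assignmentDual n) x) (meanMax n)
    linarith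
  -- With an empty set the logarithm is `0`, so the width term is negative; following the maximizer
  -- at `x`, whose perturbation has mean zero, is enough.
  · rw [hH, Finset.not_nonempty_iff_eq_empty.1 hA]
    obtain ⟨u, hu⟩ := exists_eq_fieldMax (fun u x => assignmentDual n u x) x
    have hu' : dualMax (assignmentDual n) x = assignmentDual n u x := hu
    have hi := (integrable_assignmentDual hn1 u).const_mul s
    have h1 : dualMax (assignmentDual n) x ≤
        ∫ y, dualMax (assignmentDual n) (x + s • y) ∂γ := by
      have h2 : ∫ y, (assignmentDual n u x + s * assignmentDual n u y) ∂γ =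
          dualMax (assignmentDual n) x := by
        rw [integral_add (integrable_const _) hi, integral_const_mul,
          integral_strongDual_stdGaussianPi, hu']
        simp
      rw [← h2]
      exact integral_mono ((integrable_const _).add hi) hint fun y => hle u y
    have h3 : s * ((Real.log ((∅ : Finset (Equiv.Perm (Fin n))).card : ℝ) - 1) /
        (4 * √(n * Real.log n))) ≤ 0 := by
      refine mul_nonpos_of_nonneg_of_nonpos hs.le (div_nonpos_of_nonpos_of_nonneg ?_ (by positivity))
      simp
    have h4 := min_le_left (dualMax (assignmentDual n) x) (meanMax n)
    have h5 := mul_nonneg hε hm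
    linarith

/-- The bound on the mean log-cardinality of the near-maximal set, with the perturbation strength
`s` left free. -/
lemma integral_canonicalLogCard_le (hn : 2 ≤ n) {s ε : ℝ} (hs : 0 < s) (hε : 0 ≤ ε) :
    ∫ x, canonicalLogCard n ε x ∂(stdGaussianPi (Fin n × Fin n)) ≤
      1 + 4 * √(n * Real.log n) * ((s / 2 + ε / s) * (2 * √(n * Real.log n)) +
        Real.pi * gaussianAbsMoment / s) := by
  have hn1 : 1 ≤ n := by omega
  have hn2 : (2 : ℝ) ≤ n := by exact_mod_cast hn
  have hL : 0 < n * Real.log n := mul_pos (by linarith) (Real.log_pos (by linarith))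
  have hr : 0 < √(n * Real.log n) := Real.sqrt_pos.2 hL
  have hm := meanMax_nonneg hn1
  have hm2 := meanMax_le hn
  have hM := integrable_dualMax (map_assignmentDual hn1)
  have hH := integrable_canonicalLogCard (n := n) ε
  have hpsi := integrable_dualMax_add_smul integral_strongDual_stdGaussianPi
    (map_assignmentDual hn1) s
  have hpsi2 := integral_dualMax_add_smul (L := assignmentDual n)
    integral_strongDual_stdGaussianPi s
  rw [integral_prod _ hpsi] at hpsi2
  have hconc := integral_abs_dualMax_sub_le integral_strongDual_stdGaussianPi
    (map_assignmentDual hn1)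
  set γ := stdGaussianPi (Fin n × Fin n)
  set r := √(n * Real.log n)
  set D := Real.pi * gaussianAbsMoment
  change _ = _ * meanMax n at hpsi2
  change ∫ x, |dualMax (assignmentDual n) x - meanMax n| ∂γ ≤ D at hconc
  have hdev : Integrable (fun x => |dualMax (assignmentDual n) x - meanMax n|) γ :=
    (hM.sub (integrable_const _)).abs
  have hH' : Integrable (fun x => s * ((canonicalLogCard n ε x - 1) / (4 * r))) γ :=
    ((hH.sub (integrable_const _)).div_const _).const_mul _
  have hdev' : Integrable (fun x => (1 - ε) * meanMax n -
      |dualMax (assignmentDual n) x - meanMax n|) γ := (integrable_const _).sub hdev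
  have hlow : ∫ x, (s * ((canonicalLogCard n ε x - 1) / (4 * r)) +
      (((1 - ε) * meanMax n) - |dualMax (assignmentDual n) x - meanMax n|)) ∂γ ≤
      √(1 + s ^ 2) * meanMax n := by
    rw [← hpsi2]
    refine integral_mono (hH'.add hdev') hpsi.integral_prod_left
      fun x => ?_
    -- Replacing the minimum by `m - |M x - m|` covers both cases of the pointwise bound and costs
    -- only the mean deviation.
    have h1 := le_integral_dualMax_translate hn hs hε x
    have h2 : meanMax n - |dualMax (assignmentDual n) x - meanMax n| ≤
        min (dualMax (assignmentDual n) x) (meanMax n) := by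
      refine le_min ?_ ?_
      · linarith [neg_abs_le (dualMax (assignmentDual n) x - meanMax n)]
      · linarith [abs_nonneg (dualMax (assignmentDual n) x - meanMax n)]
    refine le_trans ?_ h1
    beta_reduce
    linarith
  rw [integral_add hH' hdev', integral_sub (integrable_const _) hdev,
    integral_const_mul, integral_div, integral_sub hH (integrable_const _)] at hlow
  simp only [integral_const, probReal_univ, one_smul] at hlow
  have hsq : √(1 + s ^ 2) ≤ 1 + s ^ 2 / 2 := by
    rw [Real.sqrt_le_left (by positivity)]
    nlinarith [sq_nonneg (s ^ 2)]
  have h1 := mul_le_mul_of_nonneg_right hsq hm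
  set I := ∫ x, canonicalLogCard n ε x ∂γ
  have h2 : s * ((I - 1) / (4 * r)) ≤ (s ^ 2 / 2 + ε) * (2 * r) + D := by
    have : (s ^ 2 / 2 + ε) * meanMax n ≤ (s ^ 2 / 2 + ε) * (2 * r) := by gcongr
    linarith
  have h3 : s * ((I - 1) / (4 * r)) = (I - 1) * (s / (4 * r)) := by ring
  rw [h3, ← le_div_iff₀ (by positivity)] at h2
  have h4 : ((s ^ 2 / 2 + ε) * (2 * r) + D) / (s / (4 * r)) =
      4 * r * ((s / 2 + ε / s) * (2 * r) + D / s) := by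
    field_simp
  linarith

lemma one_le_mul_log (hn : 2 ≤ n) : 1 ≤ n * Real.log n := by
  have hn2 : (2 : ℝ) ≤ n := by exact_mod_cast hn
  have h1 : Real.log 2 ≤ Real.log n := Real.log_le_log (by norm_num) hn2
  have h2 := Real.log_two_gt_d9
  nlinarith

/-- Writing `n log n = q ^ 4` turns the fractional powers in the bounds into polynomials in `q`. -/
lemma exists_fourth_root {x : ℝ} (hx : 1 ≤ x) :
    ∃ q : ℝ, 1 ≤ q ∧ x = q ^ 4 ∧ √x = q ^ 2 ∧ x ^ (3 / 4 : ℝ) = q ^ 3 := by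
  have h0 : 0 ≤ x := by linarith
  refine ⟨x ^ (1 / 4 : ℝ), Real.one_le_rpow hx (by norm_num), ?_, ?_, ?_⟩
  · rw [← Real.rpow_natCast, ← Real.rpow_mul h0]; norm_num
  · rw [← Real.rpow_natCast, ← Real.rpow_mul h0, Real.sqrt_eq_rpow]; norm_num
  · rw [← Real.rpow_natCast, ← Real.rpow_mul h0]; norm_num

lemma rpow_neg_half_eq {x : ℝ} (hx : 0 ≤ x) : x ^ (-(1 / 2) : ℝ) = 1 / √x := by
  rw [Real.rpow_neg hx, ← Real.sqrt_eq_rpow, one_div]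

lemma gaussianAbsMoment_nonneg : 0 ≤ gaussianAbsMoment := integral_nonneg fun _ => abs_nonneg _

lemma integral_canonicalLogCard_le_of_le (hn : 2 ≤ n) {ε : ℝ} (hε : 0 < ε)
    (h : ε ≤ (2 * (n : ℝ) * Real.log n) ^ (-(1 / 2) : ℝ)) :
    ∫ x, canonicalLogCard n ε x ∂(stdGaussianPi (Fin n × Fin n)) ≤
      (13 + 4 * (Real.pi * gaussianAbsMoment)) * ((n : ℝ) * Real.log n) ^ (3 / 4 : ℝ) := by
  have hL := one_le_mul_log hn
  rw [mul_assoc, rpow_neg_half_eq (by positivity)] at h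
  have hD : 0 ≤ Real.pi * gaussianAbsMoment := mul_nonneg Real.pi_pos.le gaussianAbsMoment_nonneg
  obtain ⟨q, hq, h4, h2, h3⟩ := exists_fourth_root hL
  have hq0 : 0 < q := by linarith
  -- In this regime `ε ≤ q⁻²`; taking `s = 1 / q` makes the contributions of `s² m` and of the
  -- fluctuations comparable, both of order `q ^ 3`.
  have hb := integral_canonicalLogCard_le hn (s := 1 / q) (by positivity) hε.le
  have hεq : ε ≤ 1 / q ^ 2 := by
    refine h.trans ?_
    rw [← h2]
    exact one_div_le_one_div_of_le (Real.sqrt_pos.2 (by linarith)) (Real.sqrt_le_sqrt (by linarith))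
  rw [h2] at hb
  rw [h3]
  have h5 : 1 + 4 * q ^ 2 * ((1 / q / 2 + ε / (1 / q)) * (2 * q ^ 2) +
      Real.pi * gaussianAbsMoment / (1 / q)) =
      1 + 4 * q ^ 3 + 8 * (ε * q ^ 2) * q ^ 3 + 4 * (Real.pi * gaussianAbsMoment) * q ^ 3 := by
    field_simp; ring
  have h6 : ε * q ^ 2 ≤ 1 := (le_div_iff₀ (by positivity)).1 hεq
  have h7 : 1 ≤ q ^ 3 := one_le_pow₀ hq
  have h8 : ε * q ^ 2 * q ^ 3 ≤ 1 * q ^ 3 := by gcongr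
  linarith

lemma integral_canonicalLogCard_le_of_lt (hn : 2 ≤ n) {ε : ℝ}
    (h : (2 * (n : ℝ) * Real.log n) ^ (-(1 / 2) : ℝ) < ε) :
    ∫ x, canonicalLogCard n ε x ∂(stdGaussianPi (Fin n × Fin n)) ≤
      (14 + 8 * (Real.pi * gaussianAbsMoment)) * √ε * ((n : ℝ) * Real.log n) := by
  have hL := one_le_mul_log hn
  rw [mul_assoc, rpow_neg_half_eq (by positivity)] at h
  have hε : 0 < ε := lt_of_le_of_lt (by positivity) h
  have hD : 0 ≤ Real.pi * gaussianAbsMoment := mul_nonneg Real.pi_pos.le gaussianAbsMoment_nonneg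
  obtain ⟨q, hq, h4, h2, h3⟩ := exists_fourth_root hL
  have hq0 : 0 < q := by linarith
  set e := √ε with he
  have he0 : 0 < e := Real.sqrt_pos.2 hε
  have hee : ε = e ^ 2 := (Real.sq_sqrt hε.le).symm
  -- The strength `s = √ε` balances `s / 2` against `ε / s`. The lower bound on `ε`, in the form
  -- `h5`, then absorbs the fluctuation term and the constant `1`.
  have hb := integral_canonicalLogCard_le hn he0 hε.le
  have h5 : 1 ≤ 2 * e ^ 2 * q ^ 2 := by
    have h6 : √(2 * (n * Real.log n)) ≤ 2 * q ^ 2 := by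
      rw [h4, Real.sqrt_le_left (by positivity)]
      nlinarith [pow_pos hq0 4]
    have h7 := h.le
    rw [div_le_iff₀ (Real.sqrt_pos.2 (by linarith)), hee] at h7
    have h8 : e ^ 2 * √(2 * (n * Real.log n)) ≤ e ^ 2 * (2 * q ^ 2) := by gcongr
    linarith
  rw [h2, hee] at hb
  rw [h4, hee]
  have h6 : 1 + 4 * q ^ 2 * ((e / 2 + e ^ 2 / e) * (2 * q ^ 2) +
      Real.pi * gaussianAbsMoment / e) =
      1 + 12 * (e * q ^ 4) + 4 * (Real.pi * gaussianAbsMoment) * (q ^ 2 / e) := by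
    field_simp; ring
  have h7 : q ^ 2 / e ≤ 2 * (e * q ^ 4) := by
    rw [div_le_iff₀ he0]
    nlinarith [mul_le_mul_of_nonneg_left h5 (sq_nonneg q)]
  have h8 : 1 ≤ 2 * (e * q ^ 4) := by
    have h9 : 1 / 2 ≤ e * q := by
      by_contra! hc
      nlinarith [mul_pos he0 hq0]
    have h10 : e * q * 1 ≤ e * q * q ^ 3 := by gcongr; exact one_le_pow₀ hq
    nlinarith
  have h9 : 4 * (Real.pi * gaussianAbsMoment) * (q ^ 2 / e) ≤
      4 * (Real.pi * gaussianAbsMoment) * (2 * (e * q ^ 4)) := by gcongr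
  linarith

end NearMaximal

/-! ### Transfer from the canonical Gaussian space to an arbitrary probability space. -/

section Transfer

variable {Ω : Type*} [MeasurableSpace Ω] {P : Measure Ω} [IsProbabilityMeasure P] {n : ℕ}
  {c : Fin n → Fin n → Ω → ℝ}

lemma IsStdGaussianMatrix.aemeasurable (hc : IsStdGaussianMatrix P c) :
    AEMeasurable (fun ω (p : Fin n × Fin n) => c p.1 p.2 ω) P :=
  aemeasurable_pi_iff.2 fun p => (hc.hasLaw p.1 p.2).aemeasurable

lemma IsStdGaussianMatrix.map_eq (hc : IsStdGaussianMatrix P c) :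
    P.map (fun ω (p : Fin n × Fin n) => c p.1 p.2 ω) = stdGaussianPi (Fin n × Fin n) := by
  have h := (iIndepFun_iff_map_fun_eq_pi_map
    (fun p : Fin n × Fin n => (hc.hasLaw p.1 p.2).aemeasurable)).1 hc.indep
  rw [h, stdGaussianPi]
  congr 1
  ext1 p
  exact (hc.hasLaw p.1 p.2).map_eq

lemma assignmentField_eq (c : Fin n → Fin n → Ω → ℝ) (u : Equiv.Perm (Fin n)) (ω : Ω) :
    assignmentField c u ω = assignmentDual n u (fun p => c p.1 p.2 ω) := by
  rw [assignmentDual_apply]; rfl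

lemma fieldMax_assignmentField (c : Fin n → Fin n → Ω → ℝ) (ω : Ω) :
    fieldMax (assignmentField c) ω = dualMax (assignmentDual n) (fun p => c p.1 p.2 ω) := by
  simp only [fieldMax, dualMax, assignmentField_eq]

lemma IsStdGaussianMatrix.integrable_fieldMax (hc : IsStdGaussianMatrix P c) (hn : 1 ≤ n) :
    Integrable (fieldMax (assignmentField c)) P := by
  have h := integrable_dualMax (map_assignmentDual hn)
  rw [← hc.map_eq, integrable_map_measure (by fun_prop) hc.aemeasurable] at h
  exact h.congr (ae_of_all _ fun ω => (fieldMax_assignmentField c ω).symm)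

lemma IsStdGaussianMatrix.logCardNearMaximal_eq (hc : IsStdGaussianMatrix P c) (ε : ℝ) (ω : Ω) :
    logCardNearMaximal P (assignmentField c) ε ω =
      canonicalLogCard n ε (fun p => c p.1 p.2 ω) := by
  have h : ∫ ω, fieldMax (assignmentField c) ω ∂P =
      ∫ x, dualMax (assignmentDual n) x ∂(stdGaussianPi (Fin n × Fin n)) := by
    rw [← hc.map_eq, integral_map hc.aemeasurable (by fun_prop)]
    simp_rw [fieldMax_assignmentField]
  rw [canonicalLogCard, logCardNearMaximal_eq_log_card, logCardNearMaximal_eq_log_card,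
    nearMaximalSet, nearMaximalSet, h]
  simp only [assignmentField_eq]
  rfl

lemma IsStdGaussianMatrix.integrable_logCardNearMaximal (hc : IsStdGaussianMatrix P c) (ε : ℝ) :
    Integrable (logCardNearMaximal P (assignmentField c) ε) P := by
  have h := integrable_canonicalLogCard (n := n) ε
  rw [← hc.map_eq, integrable_map_measure (by exact h.aestronglyMeasurable)
    hc.aemeasurable] at h
  exact h.congr (ae_of_all _ fun ω => (hc.logCardNearMaximal_eq ε ω).symm)

lemma IsStdGaussianMatrix.integral_logCardNearMaximal (hc : IsStdGaussianMatrix P c) (ε : ℝ) :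
    ∫ ω, logCardNearMaximal P (assignmentField c) ε ω ∂P =
      ∫ x, canonicalLogCard n ε x ∂(stdGaussianPi (Fin n × Fin n)) := by
  simp_rw [hc.logCardNearMaximal_eq ε]
  rw [← hc.map_eq, integral_map hc.aemeasurable]
  rw [hc.map_eq]
  exact (integrable_canonicalLogCard ε).aestronglyMeasurable

end Transfer

/-! ### The case `n = 1`, the limit, and the theorem. -/

lemma canonicalLogCard_one (ε : ℝ) (x : Fin 1 × Fin 1 → ℝ) : canonicalLogCard 1 ε x = 0 := by
  refine le_antisymm ?_ (logCardNearMaximal_nonneg _ _ _ _)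
  refine (logCardNearMaximal_le _ _ _ _).trans ?_
  simp

/-- The single term `n ^ n / n!` of the exponential series at `n` is at most `exp n`. -/
lemma mul_log_sub_le_log_factorial {n : ℕ} (hn : 1 ≤ n) :
    n * Real.log n - n ≤ Real.log (n.factorial : ℝ) := by
  have hn0 : (0 : ℝ) < n := by exact_mod_cast hn
  have hf : (0 : ℝ) < n.factorial := by exact_mod_cast n.factorial_pos
  have h := Real.pow_div_factorial_le_exp n hn0.le n
  have h2 := Real.log_le_log (by positivity) h
  rw [Real.log_exp, Real.log_div (by positivity) hf.ne', Real.log_pow] at h2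
  linarith

lemma tendsto_mul_log_atTop : Tendsto (fun n : ℕ => (n : ℝ) * Real.log n) atTop atTop :=
  tendsto_natCast_atTop_atTop.atTop_mul_atTop₀ (Real.tendsto_log_atTop.comp tendsto_natCast_atTop_atTop)

/-- The mean dimension of the near-maximal set vanishes as the tolerance does. -/
lemma tendsto_integral_canonicalLogCard_div {ε : ℕ → ℝ} (hε : ∀ n, 0 < ε n)
    (hε0 : Tendsto ε atTop (𝓝 0)) :
    Tendsto (fun n : ℕ => (∫ x, canonicalLogCard n (ε n) x ∂(stdGaussianPi (Fin n × Fin n))) /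
      Real.log (n.factorial : ℝ)) atTop (𝓝 0) := by
  set C₁ := 13 + 4 * (Real.pi * gaussianAbsMoment) with hC₁
  set C₂ := 14 + 8 * (Real.pi * gaussianAbsMoment) with hC₂
  have hD : 0 ≤ Real.pi * gaussianAbsMoment := mul_nonneg Real.pi_pos.le gaussianAbsMoment_nonneg
  have hlim : Tendsto (fun n : ℕ => 2 * C₁ * ((n : ℝ) * Real.log n) ^ (-(1 / 4) : ℝ) +
      2 * C₂ * √(ε n)) atTop (𝓝 0) := by
    have h1 := ((tendsto_rpow_neg_atTop (y := 1 / 4) (by norm_num)).comp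
      tendsto_mul_log_atTop).const_mul (2 * C₁)
    have h2 := (hε0.sqrt).const_mul (2 * C₂)
    simpa using h1.add h2
  have hlog : ∀ᶠ n : ℕ in atTop, 2 ≤ Real.log n :=
    (Real.tendsto_log_atTop.comp tendsto_natCast_atTop_atTop).eventually_ge_atTop 2
  refine tendsto_of_tendsto_of_tendsto_of_le_of_le' tendsto_const_nhds hlim ?_ ?_
  · exact Eventually.of_forall fun n => div_nonneg
      (integral_nonneg fun x => logCardNearMaximal_nonneg _ _ _ _) (Real.log_natCast_nonneg _)
  · filter_upwards [hlog, eventually_ge_atTop 2] with n hl hn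
    have hn0 : (0 : ℝ) ≤ n := n.cast_nonneg
    have hL := one_le_mul_log hn
    set L := (n : ℝ) * Real.log n with hLdef
    -- Once `log n ≥ 2`, the loss `n` is at most half of `n log n`; this explains the factors `2` in
    -- `hlim`.
    have hfac : L / 2 ≤ Real.log (n.factorial : ℝ) := by
      have := mul_log_sub_le_log_factorial (n := n) (by omega)
      nlinarith
    have hL0 : 0 < L := by linarith
    have hpow : L ^ (3 / 4 : ℝ) = L ^ (-(1 / 4) : ℝ) * L := by
      rw [← Real.rpow_add_one hL0.ne']; norm_num
    have hp0 : 0 ≤ L ^ (-(1 / 4) : ℝ) := Real.rpow_nonneg hL0.le _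
    have hbound : ∫ x, canonicalLogCard n (ε n) x ∂(stdGaussianPi (Fin n × Fin n)) ≤
        (C₁ * L ^ (-(1 / 4) : ℝ) + C₂ * √(ε n)) * L := by
      have hs : 0 ≤ √(ε n) := Real.sqrt_nonneg _
      rcases le_or_gt (ε n) ((2 * (n : ℝ) * Real.log n) ^ (-(1 / 2) : ℝ)) with h | h
      · have := integral_canonicalLogCard_le_of_le hn (hε n) h
        rw [← hLdef, hpow] at this
        have h2 : 0 ≤ C₂ * √(ε n) * L := by positivity
        linarith
      · have := integral_canonicalLogCard_le_of_lt hn h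
        have h2 : 0 ≤ C₁ * L ^ (-(1 / 4) : ℝ) * L := by positivity
        rw [← hLdef] at this
        linarith
    rw [div_le_iff₀ (by linarith)]
    refine hbound.trans ?_
    have h3 : 0 ≤ 2 * C₁ * L ^ (-(1 / 4) : ℝ) + 2 * C₂ * √(ε n) := by positivity
    have h4 := mul_le_mul_of_nonneg_left hfac h3
    linarith

theorem theorem2 :
    (∃ C' C'' : ℝ,
      ∀ (n : ℕ), 1 ≤ n →
      ∀ (Ω : Type*) [MeasurableSpace Ω] (P : Measure Ω) [IsProbabilityMeasure P]
        (c : Fin n → Fin n → Ω → ℝ), IsStdGaussianMatrix P c →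
        Integrable (fieldMax (assignmentField c)) P ∧
        ∀ ε : ℝ, 0 < ε →
          Integrable (logCardNearMaximal P (assignmentField c) ε) P ∧
          (ε ≤ (2 * (n : ℝ) * Real.log n) ^ (-(1 / 2) : ℝ) →
            ∫ ω, logCardNearMaximal P (assignmentField c) ε ω ∂P
              ≤ C' * ((n : ℝ) * Real.log n) ^ (3 / 4 : ℝ)) ∧
          ((2 * (n : ℝ) * Real.log n) ^ (-(1 / 2) : ℝ) < ε → ε < 1 →
            ∫ ω, logCardNearMaximal P (assignmentField c) ε ω ∂P
              ≤ C'' * √ε * ((n : ℝ) * Real.log n))) ∧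
    (∀ (Ω : ℕ → Type*) [∀ n, MeasurableSpace (Ω n)] (P : ∀ n, Measure (Ω n))
        [∀ n, IsProbabilityMeasure (P n)] (c : ∀ n, Fin n → Fin n → Ω n → ℝ),
        (∀ n, IsStdGaussianMatrix (P n) (c n)) →
        ∀ ε : ℕ → ℝ, (∀ n, 0 < ε n) → Tendsto ε atTop (𝓝 0) →
          Tendsto (fun n : ℕ =>
            ∫ ω, logCardNearMaximal (P n) (assignmentField (c n)) (ε n) ω
              / Real.log (n.factorial : ℝ) ∂(P n)) atTop (𝓝 0)) := by
  refine ⟨⟨13 + 4 * (Real.pi * gaussianAbsMoment), 14 + 8 * (Real.pi * gaussianAbsMoment),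
    fun n hn Ω _ P _ c hc => ⟨hc.integrable_fieldMax hn, fun ε hε =>
      ⟨hc.integrable_logCardNearMaximal ε, ?_, ?_⟩⟩⟩, ?_⟩
  · intro h
    rw [hc.integral_logCardNearMaximal]
    -- For `n = 1` the threshold is `0 ^ (-1/2)`, which `Real.rpow` evaluates to `0`. Nothing hinges
    -- on that value, since both sides of either bound vanish.
    rcases hn.eq_or_lt with rfl | hn
    · simp [canonicalLogCard_one]
    · exact integral_canonicalLogCard_le_of_le hn hε h
  · intro h _
    rw [hc.integral_logCardNearMaximal]
    rcases hn.eq_or_lt with rfl | hn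
    · simp [canonicalLogCard_one]
    · exact integral_canonicalLogCard_le_of_lt hn h
  · intro Ω _ P _ c hc ε hε hε0
    refine (tendsto_integral_canonicalLogCard_div hε hε0).congr fun n => ?_
    rw [integral_div, (hc n).integral_logCardNearMaximal]
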